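/- Let $\Omega=(0,1)^2$, let $\beta_1,\beta_2,\mu_0>0$, let $b=(b_1,b_2)\in C^1(\bar\Omega)^2$ and $c\in C(\bar\Omega)$ satisfy $b_1\ge\beta_1$, $b_2\ge\beta_2$, $c\ge 0$ and $c-\tfrac12\nabla\cdot b\ge\mu_0$ on $\bar\Omega$, and let $C^*>0$ and $M>0$. Then there is a constant $C>0$, depending only on these data (and not on $\varepsilon$ or $N$), such that the following holds. Let $N$ be a positive even integer, let $0<\varepsilon\le N^{-1}$, and put $\lambda_x=\frac{5}{2}\frac{\varepsilon}{\beta_1}\ln N$, $\lambda_y=\frac52\frac{\varepsilon}{\beta_2}\ln N$; assume $\lambda_x<1$ and $\lambda_y<1$. The Shishkin mesh consists of the rectangles $K_{ij}=[x_i,x_{i+1}]\times[y_j,y_{j+1}]$, $0\le i,j<N$, where $x_i=2i(1-\lambda_x)/N$ for $0\le i\le N/2$ and $x_i=1-2(N-i)\lambda_x/N$ for $N/2<i\le N$, and $y_j$ is defined in the same way with $\lambda_y$. Let $\Omega_s=[0,1-\lambda_x]\times[0,1-\lambda_y]$, $x_t=1-\lambda_x$, $H_x=2(1-\lambda_x)/N$,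 $y_t=1-\lambda_y$, $H_y=2(1-\lambda_y)/N$, let $\xi(x)=1$ for $x\in[0,x_t-H_x]$ and $\xi(x)=(x_t-x)/H_x$ for $x\in[x_t-H_x,x_t]$, let $\eta$ be defined in the same way on $[0,y_t]$, and let $$\delta(x,y)=C^*N^{-1}\xi(x)\eta(y)\ \text{ on }\Omega_s,\qquad \delta=0\ \text{ on }\Omega\setminus\Omega_s .$$ For $D=\Omega$ or $D=\Omega_s$ put $$\|w\|_{\varepsilon;D}^2=\varepsilon\|\nabla w\|_{L^2(D)}^2+\mu_0\|w\|_{L^2(D)}^2,\qquad \|w\|_{SD;D}^2=\|w\|_{\varepsilon;D}^2+\sum_{K}\|\delta^{1/2}\,b\cdot\nabla w\|_{L^2(K\cap D)}^2,$$ the sum running over all mesh rectangles, and $\|w\|_{SD}=\|w\|_{SD;\Omega}$. Let $f\in C(\bar\Omega)$ and let $u$ solve $-\varepsilon\Delta u+b\cdot\nabla u+cu=f$ in $\Omega$, $u=0$ on $\partial\Omega$. Suppose that $u=S+E_1+E_2+E_{12}$ on $\bar\Omega$, where for all $(x,y)\in\bar\Omega$ $$|\partial_x^i\partial_y^jS|\le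 M\ (0\le i+j\le3),\qquad |\partial_x^i\partial_y^jE_1|\le M\varepsilon^{-i}e^{-\beta_1(1-x)/\varepsilon},\qquad |\partial_x^i\partial_y^jE_2|\le M\varepsilon^{-j}e^{-\beta_2(1-y)/\varepsilon},$$ $$|\partial_x^i\partial_y^jE_{12}|\le M\varepsilon^{-(i+j)}e^{-(\beta_1(1-x)+\beta_2(1-y))/\varepsilon}\qquad(0\le i,j\le2),$$ and let $u^I$ be the continuous function that is bilinear on each $K_{ij}$ and agrees with $u$ at all mesh points $(x_i,y_j)$, $0\le i,j\le N$. Then $$\|u-u^I\|_{SD}\le C N^{-1}\ln N,$$ $$\|u-u^I\|_{\varepsilon;\Omega_s}^2\le C(\varepsilon N^{-2}+N^{-4}),\qquad \|u-u^I\|_{SD;\Omega_s}^2\le C N^{-3}.$$ -/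

import Mathlib

open Set MeasureTheory
open scoped ENNReal ContDiff

namespace SDFEM

noncomputable section

/-- The open unit square `Ω = (0,1)²`. -/
def Omega : Set (ℝ × ℝ) := Ioo 0 1 ×ˢ Ioo 0 1

/-- The closed unit square, the closure of `Ω`. -/
def OmegaBar : Set (ℝ × ℝ) := Icc 0 1 ×ˢ Icc 0 1

/-! ### The boundary value problem -/

/-- The divergence of `(b₁, b₂)` on the closed square (one-sided derivatives at the boundary). -/
def divergence (b₁ b₂ : ℝ × ℝ → ℝ) (p : ℝ × ℝ) : ℝ :=
  fderivWithin ℝ b₁ OmegaBar p (1, 0) + fderivWithin ℝ b₂ OmegaBar p (0, 1)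

/-- The standing assumptions on the convection field `b = (b₁, b₂)` and the reaction term `c`. -/
structure IsCoefficientData (β₁ β₂ μ₀ : ℝ) (b₁ b₂ c : ℝ × ℝ → ℝ) : Prop where
  beta₁_pos : 0 < β₁
  beta₂_pos : 0 < β₂
  mu₀_pos : 0 < μ₀
  smooth_b₁ : ContDiffOn ℝ 1 b₁ OmegaBar
  smooth_b₂ : ContDiffOn ℝ 1 b₂ OmegaBar
  continuous_c : ContinuousOn c OmegaBar
  le_b₁ : ∀ p ∈ OmegaBar, β₁ ≤ b₁ p
  le_b₂ : ∀ p ∈ OmegaBar, β₂ ≤ b₂ p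
  c_nonneg : ∀ p ∈ OmegaBar, 0 ≤ c p
  coercive : ∀ p ∈ OmegaBar, μ₀ ≤ c p - 1 / 2 * divergence b₁ b₂ p

/-- `u` solves `-ε Δu + b·∇u + c u = f` in `Ω`, `u = 0` on `∂Ω`. The functions `ux, uy, uxx, uyy`
are the partial derivatives of `u` in `Ω`, whose existence is part of the definition. -/
def IsSolution (ε : ℝ) (b₁ b₂ c f u : ℝ × ℝ → ℝ) : Prop :=
  ContinuousOn u OmegaBar ∧ (∀ p ∈ frontier Omega, u p = 0) ∧
  ∃ ux uy uxx uyy : ℝ × ℝ → ℝ, ∀ p ∈ Omega,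
    HasDerivAt (fun s => u (s, p.2)) (ux p) p.1 ∧
    HasDerivAt (fun t => u (p.1, t)) (uy p) p.2 ∧
    HasDerivAt (fun s => ux (s, p.2)) (uxx p) p.1 ∧
    HasDerivAt (fun t => uy (p.1, t)) (uyy p) p.2 ∧
    -ε * (uxx p + uyy p) + (b₁ p * ux p + b₂ p * uy p) + c p * u p = f p

/-! ### The solution decomposition -/

/-- For `(i, j)` in the (downward closed) index set `A`, the function `D i j` is the partial
derivative `∂^{i+j} v / ∂x^i ∂y^j` on the closed unit square (one-sided at the boundary). -/
structure HasPartials (A : ℕ → ℕ → Prop) (v : ℝ × ℝ → ℝ) (D : ℕ → ℕ → ℝ × ℝ → ℝ) : Prop where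
  zero : ∀ p ∈ OmegaBar, D 0 0 p = v p
  dx : ∀ i j, A (i + 1) j → ∀ p ∈ OmegaBar,
    HasDerivWithinAt (fun s => D i j (s, p.2)) (D (i + 1) j p) (Icc 0 1) p.1
  dy : ∀ i j, A i (j + 1) → ∀ p ∈ OmegaBar,
    HasDerivWithinAt (fun t => D i j (p.1, t)) (D i (j + 1) p) (Icc 0 1) p.2

/-- For `(i, j)` in `A`, the partial derivative `∂^{i+j} v / ∂x^i ∂y^j` exists on the closed unit
square and is bounded there by `B i j`. -/
def PartialsBounded (A : ℕ → ℕ → Prop) (v : ℝ × ℝ → ℝ) (B : ℕ → ℕ → ℝ × ℝ → ℝ) : Prop :=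
  ∃ D : ℕ → ℕ → ℝ × ℝ → ℝ, HasPartials A v D ∧
    ∀ i j, A i j → ∀ p ∈ OmegaBar, |D i j p| ≤ B i j p

/-- The decomposition `u = S + E₁ + E₂ + E₁₂` into a regular part, two exponential layers and a
corner layer, with derivative bounds governed by the constant `M`. (The bounds on `S` contain
`S ∈ W^{3,∞}(Ω)`, hence a bound on the norm of `S` in `H³(Ω)` by a multiple of `M`.) -/
structure IsDecomposition (ε β₁ β₂ M : ℝ) (u S E₁ E₂ E₁₂ : ℝ × ℝ → ℝ) : Prop where
  sum_eq : ∀ p ∈ OmegaBar, u p = S p + E₁ p + E₂ p + E₁₂ p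
  regular : PartialsBounded (fun i j => i + j ≤ 3) S (fun _ _ _ => M)
  layer₁ : PartialsBounded (fun i j => i ≤ 2 ∧ j ≤ 2) E₁
    (fun i _ p => M * (ε ^ i)⁻¹ * Real.exp (-(β₁ * (1 - p.1)) / ε))
  layer₂ : PartialsBounded (fun i j => i ≤ 2 ∧ j ≤ 2) E₂
    (fun _ j p => M * (ε ^ j)⁻¹ * Real.exp (-(β₂ * (1 - p.2)) / ε))
  layer₁₂ : PartialsBounded (fun i j => i ≤ 2 ∧ j ≤ 2) E₁₂
    (fun i j p => M * (ε ^ (i + j))⁻¹ *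
      Real.exp (-(β₁ * (1 - p.1) + β₂ * (1 - p.2)) / ε))

/-! ### The Shishkin mesh and the piecewise bilinear interpolant -/

/-- The width `λ = ρ (ε / β) ln N`, `ρ = 2.5`, of the fine part of the mesh in one direction. -/
def layerWidth (ε β : ℝ) (N : ℕ) : ℝ := 5 / 2 * (ε / β) * Real.log N

/-- The `i`-th node of the one-dimensional Shishkin mesh with `N` intervals and width `l`. -/
def node (l : ℝ) (N i : ℕ) : ℝ :=
  if 2 * i ≤ N then 2 * (i : ℝ) * (1 - l) / N else 1 - 2 * ((N : ℝ) - i) * l / N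

/-- The mesh rectangle `K_{ij} = [x_i, x_{i+1}] × [y_j, y_{j+1}]`. -/
def cell (lx ly : ℝ) (N i j : ℕ) : Set (ℝ × ℝ) :=
  Icc (node lx N i) (node lx N (i + 1)) ×ˢ Icc (node ly N j) (node ly N (j + 1))

/-- The coarse part `Ω_s = [0, 1 - λ_x] × [0, 1 - λ_y]`. -/
def OmegaS (lx ly : ℝ) : Set (ℝ × ℝ) := Icc 0 (1 - lx) ×ˢ Icc 0 (1 - ly)

/-- `v` is the piecewise bilinear nodal interpolant of `u`: it is in `Q₁(K)` on every mesh
rectangle `K` and agrees with `u` at every mesh point. These conditions determine `v` on the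
closed unit square (and force it to be continuous there). -/
structure IsBilinearInterpolant (lx ly : ℝ) (N : ℕ) (u v : ℝ × ℝ → ℝ) : Prop where
  bilinear : ∀ i < N, ∀ j < N, ∃ a₀ a₁ a₂ a₃ : ℝ, ∀ p ∈ cell lx ly N i j,
    v p = a₀ + a₁ * p.1 + a₂ * p.2 + a₃ * (p.1 * p.2)
  interpolates : ∀ i ≤ N, ∀ j ≤ N,
    v (node lx N i, node ly N j) = u (node lx N i, node ly N j)

/-! ### The modified stabilization parameter -/

/-- The tapering function (`ξ` in the `x`-direction, `η` in the `y`-direction): with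
`t = 1 - l` and `H = (1 - l) / (N / 2)` it is `1` up to `t - H` and `(t - x) / H` on `[t - H, t]`. -/
def taper (l : ℝ) (N : ℕ) (x : ℝ) : ℝ :=
  if x ≤ (1 - l) - (1 - l) / (N / 2) then 1 else ((1 - l) - x) / ((1 - l) / (N / 2))

open Classical in
/-- The stabilization parameter `δ`: `C* N⁻¹ ξ(x) η(y)` on `Ω_s` and `0` elsewhere. -/
def delta (Cstar lx ly : ℝ) (N : ℕ) (p : ℝ × ℝ) : ℝ :=
  if p ∈ OmegaS lx ly then Cstar * (N : ℝ)⁻¹ * taper lx N p.1 * taper ly N p.2 else 0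

/-! ### Norms -/

/-- `g` is the weak (distributional) gradient of `w` on the open set `U`. -/
structure IsWeakGradient (U : Set (ℝ × ℝ)) (w : ℝ × ℝ → ℝ) (g : ℝ × ℝ → ℝ × ℝ) : Prop where
  locallyIntegrable : LocallyIntegrableOn w U
  locallyIntegrable_fst : LocallyIntegrableOn (fun p => (g p).1) U
  locallyIntegrable_snd : LocallyIntegrableOn (fun p => (g p).2) U
  integral_dx : ∀ φ : ℝ × ℝ → ℝ, ContDiff ℝ ∞ φ → HasCompactSupport φ → tsupport φ ⊆ U →
    ∫ p in U, w p * fderiv ℝ φ p (1, 0) = -∫ p in U, (g p).1 * φ p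
  integral_dy : ∀ φ : ℝ × ℝ → ℝ, ContDiff ℝ ∞ φ → HasCompactSupport φ → tsupport φ ⊆ U →
    ∫ p in U, w p * fderiv ℝ φ p (0, 1) = -∫ p in U, (g p).2 * φ p

/-- `ε ‖g‖²_D + μ₀ ‖w‖²_D`, with `L²(D)` norms. -/
def energyForm (ε μ₀ : ℝ) (D : Set (ℝ × ℝ)) (w : ℝ × ℝ → ℝ) (g : ℝ × ℝ → ℝ × ℝ) : ℝ≥0∞ :=
  ENNReal.ofReal ε * (∫⁻ p in D, ENNReal.ofReal ((g p).1 ^ 2 + (g p).2 ^ 2)) +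
    ENNReal.ofReal μ₀ * (∫⁻ p in D, ENNReal.ofReal (w p ^ 2))

/-- `∑_K ‖δ^{1/2} b·g‖²`, each norm being that of `L²(K ∩ D)`. -/
def stabForm (b₁ b₂ : ℝ × ℝ → ℝ) (Cstar lx ly : ℝ) (N : ℕ) (D : Set (ℝ × ℝ))
    (g : ℝ × ℝ → ℝ × ℝ) : ℝ≥0∞ :=
  ∑ i ∈ Finset.range N, ∑ j ∈ Finset.range N, ∫⁻ p in cell lx ly N i j ∩ D,
    ENNReal.ofReal ((√(delta Cstar lx ly N p) * (b₁ p * (g p).1 + b₂ p * (g p).2)) ^ 2)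

/-- The squared energy norm `‖w‖²_{ε;D} = ε |w|²_{1,D} + μ₀ ‖w‖²_D`. Weak gradients agree almost
everywhere, so the infimum is the value at the weak gradient of `w` in the interior of `D`; it is
`∞` if `w` has none. -/
def energyNormSq (ε μ₀ : ℝ) (D : Set (ℝ × ℝ)) (w : ℝ × ℝ → ℝ) : ℝ≥0∞ :=
  ⨅ (g : ℝ × ℝ → ℝ × ℝ) (_ : IsWeakGradient (interior D) w g), energyForm ε μ₀ D w g

/-- The squared streamline diffusion norm
`‖w‖²_{SD;D} = ε |w|²_{1,D} + μ₀ ‖w‖²_D + ∑_K ‖δ^{1/2} b·∇w‖²_{K ∩ D}`; the infimum is understood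
as in `energyNormSq`. -/
def sdNormSq (ε μ₀ : ℝ) (b₁ b₂ : ℝ × ℝ → ℝ) (Cstar lx ly : ℝ) (N : ℕ) (D : Set (ℝ × ℝ))
    (w : ℝ × ℝ → ℝ) : ℝ≥0∞ :=
  ⨅ (g : ℝ × ℝ → ℝ × ℝ) (_ : IsWeakGradient (interior D) w g),
    (energyForm ε μ₀ D w g + stabForm b₁ b₂ Cstar lx ly N D g)

/-- The streamline diffusion norm `‖w‖_{SD;D}`. -/
def sdNorm (ε μ₀ : ℝ) (b₁ b₂ : ℝ × ℝ → ℝ) (Cstar lx ly : ℝ) (N : ℕ) (D : Set (ℝ × ℝ))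
    (w : ℝ × ℝ → ℝ) : ℝ≥0∞ :=
  sdNormSq ε μ₀ b₁ b₂ Cstar lx ly N D w ^ (1 / 2 : ℝ)

end

end SDFEM

open SDFEM

/-!
The norms are infima over weak gradients, so it is enough to exhibit one weak gradient of `u - u^I`
and to bound it. The elementwise gradient is one (`IsLayerSum.isWeakGradient_error`): on each
horizontal line the error is continuous and differentiable off the mesh points, so integration by
parts is the fundamental theorem of calculus with a countable exceptional set, combined with
Fubini.

All norm bounds then follow from pointwise bounds for the error and its gradient, and from integrals
of exponentials in one variable. Write `w(x) = exp(-β₁ (1 - x) / ε)`.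

* On a single rectangle, the `x`-derivative of the interpolant is a convex combination of difference
  quotients (`abs_interpX_sub_le`), which gives stability and a first-order error estimate; the
  error itself vanishes at a corner and is controlled by its gradient (`abs_sub_interp_le`).
* On fine cells `w` varies by a factor of at most `e⁵`, and the step is `(5 / β₁) ε N⁻¹ ln N`, so
  that the gradient of the error of a layer is at most of order `N⁻¹ ln N · ε⁻¹ w(x)`.
* On coarse cells `w ≤ N⁻²`. The gradient of the layer stays `ε⁻¹ w(x)`, while its interpolant has a
  gradient of order `N⁻¹` (`layer_partial_error_coarse`): if the coarse step is at least `N⁻¹` by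
  the smallness of the nodal values, and otherwise because `ε⁻¹` is of order `ln N`.
* Exchanging the coordinates exchanges the two boundary layers (`IsLayerSum.swap`), so only
  `x`-derivatives need to be estimated.

The integral `ε ∫ (ε⁻¹ w)²` is bounded, and of order `N⁻⁴` over the coarse part. This gives the
squared energy norms `N⁻² ln² N` on `Ω` and `ε N⁻² + N⁻⁴` on `Ω_s`. In the stabilization term
`∫ (ε⁻¹ w)²` appears without the factor `ε`; here the taper `ξ`, which vanishes linearly at the
transition point, supplies a factor `ε N` (`taper_mul_layer_sq_le`), and the term is of order `N⁻³`.
-/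

namespace SDFEM

/-! ### The one-dimensional Shishkin mesh -/

lemma node_of_le {l : ℝ} {N i : ℕ} (h : 2 * i ≤ N) : node l N i = 2 * (i : ℝ) * (1 - l) / N :=
  if_pos h

lemma node_of_ge {l : ℝ} {N i : ℕ} (hN : 0 < N) (h : N ≤ 2 * i) :
    node l N i = 1 - 2 * ((N : ℝ) - i) * l / N := by
  have hN' : (N : ℝ) ≠ 0 := by positivity
  unfold node
  split_ifs with h'
  · have : (N : ℝ) = 2 * i := by exact_mod_cast le_antisymm h h'
    field_simp
    rw [this]; ring
  · rfl

lemma node_zero (l : ℝ) (N : ℕ) : node l N 0 = 0 := by simp [node]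

lemma node_last {l : ℝ} {N : ℕ} (hN : 0 < N) : node l N N = 1 := by
  rw [node_of_ge hN (by omega)]; simp

lemma node_succ_sub_of_lt {l : ℝ} {N i : ℕ} (hE : Even N) (h : 2 * i < N) :
    node l N (i + 1) - node l N i = 2 * (1 - l) / N := by
  obtain ⟨m, rfl⟩ := hE
  rw [node_of_le (by omega), node_of_le (by omega)]
  push_cast; ring

lemma node_succ_sub_of_ge {l : ℝ} {N i : ℕ} (hN : 0 < N) (h : N ≤ 2 * i) :
    node l N (i + 1) - node l N i = 2 * l / N := by
  rw [node_of_ge hN (by omega), node_of_ge hN (by omega)]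
  push_cast; ring

lemma node_lt_succ {l : ℝ} {N : ℕ} (hN : 0 < N) (hE : Even N) (h0 : 0 < l) (h1 : l < 1) (i : ℕ) :
    node l N i < node l N (i + 1) := by
  have hN' : (0 : ℝ) < N := by exact_mod_cast hN
  rw [← sub_pos]
  rcases lt_or_ge (2 * i) N with h | h
  · rw [node_succ_sub_of_lt hE h]
    have : 0 < 1 - l := by linarith
    positivity
  · rw [node_succ_sub_of_ge hN h]; positivity

lemma node_strictMono {l : ℝ} {N : ℕ} (hN : 0 < N) (hE : Even N) (h0 : 0 < l) (h1 : l < 1) :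
    StrictMono (node l N) := strictMono_nat_of_lt_succ (node_lt_succ hN hE h0 h1)

lemma node_succ_sub_le {l : ℝ} {N : ℕ} (hN : 0 < N) (hE : Even N) (h0 : 0 < l) (h1 : l < 1)
    (i : ℕ) : node l N (i + 1) - node l N i ≤ 2 / N := by
  rcases lt_or_ge (2 * i) N with h | h
  · rw [node_succ_sub_of_lt hE h]; gcongr; linarith
  · rw [node_succ_sub_of_ge hN h]; gcongr; linarith

lemma node_transition {l : ℝ} {N i : ℕ} (hN : 0 < N) (h : 2 * i = N) : node l N i = 1 - l := by
  have hN' : (N : ℝ) ≠ 0 := by positivity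
  have : (N : ℝ) = 2 * i := by exact_mod_cast h.symm
  rw [node_of_le h.le, ← this]; field_simp

lemma node_le_transition {l : ℝ} {N i : ℕ} (hN : 0 < N) (hE : Even N) (h0 : 0 < l) (h1 : l < 1)
    (h : 2 * i ≤ N) : node l N i ≤ 1 - l := by
  obtain ⟨m, hm⟩ := hE
  rw [← node_transition (i := m) hN (by omega)]
  exact (node_strictMono hN ⟨m, hm⟩ h0 h1).monotone (by omega)

lemma transition_le_node {l : ℝ} {N i : ℕ} (hN : 0 < N) (hE : Even N) (h0 : 0 < l) (h1 : l < 1)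
    (h : N ≤ 2 * i) : 1 - l ≤ node l N i := by
  obtain ⟨m, hm⟩ := hE
  rw [← node_transition (i := m) hN (by omega)]
  exact (node_strictMono hN ⟨m, hm⟩ h0 h1).monotone (by omega)

lemma node_mem_Icc {l : ℝ} {N i : ℕ} (hN : 0 < N) (hE : Even N) (h0 : 0 < l) (h1 : l < 1)
    (h : i ≤ N) : node l N i ∈ Icc (0 : ℝ) 1 := by
  have hm := (node_strictMono hN hE h0 h1).monotone
  exact ⟨node_zero l N ▸ hm (Nat.zero_le i), node_last (l := l) hN ▸ hm h⟩

open Classical in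
/-- The index of the mesh interval `[x_i, x_{i+1})` that contains `x`, for `x ∈ [0, 1)`. -/
noncomputable def meshIndex (l : ℝ) (N : ℕ) (x : ℝ) : ℕ :=
  Nat.findGreatest (fun k => node l N k ≤ x) (N - 1)

lemma measurable_meshIndex (l : ℝ) (N : ℕ) : Measurable (meshIndex l N) := by
  classical
  unfold meshIndex
  exact measurable_findGreatest fun k _ => measurableSet_Ici

lemma meshIndex_lt {l : ℝ} {N : ℕ} (hN : 0 < N) (x : ℝ) : meshIndex l N x < N := by
  classical
  have : meshIndex l N x ≤ N - 1 := Nat.findGreatest_le _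
  omega

lemma mem_Ico_meshIndex {l : ℝ} {N : ℕ} (hN : 0 < N) {x : ℝ} (hx : x ∈ Ico (0 : ℝ) 1) :
    x ∈ Ico (node l N (meshIndex l N x)) (node l N (meshIndex l N x + 1)) := by
  classical
  constructor
  · exact Nat.findGreatest_spec (P := fun k => node l N k ≤ x) (Nat.zero_le (N - 1))
      (by simpa [node_zero] using hx.1)
  · by_contra! h
    rcases Nat.lt_or_ge (meshIndex l N x) (N - 1) with h' | h'
    · exact Nat.findGreatest_is_greatest (P := fun k => node l N k ≤ x) (n := N - 1)
        (k := meshIndex l N x + 1) (Nat.lt_succ_self _) (by omega) h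
    · have := meshIndex_lt (l := l) hN x
      rw [show meshIndex l N x + 1 = N by omega, node_last hN] at h
      exact absurd hx.2 (not_lt.2 h)

lemma meshIndex_eq {l : ℝ} {N : ℕ} (hN : 0 < N) (hE : Even N) (h0 : 0 < l) (h1 : l < 1) {x : ℝ}
    {i : ℕ} (hi : i < N) (hx : x ∈ Ico (node l N i) (node l N (i + 1))) : meshIndex l N x = i := by
  have hs := node_strictMono hN hE h0 h1
  have hx' : x ∈ Ico (0 : ℝ) 1 :=
    ⟨(node_mem_Icc hN hE h0 h1 hi.le).1.trans hx.1, hx.2.trans_le (node_mem_Icc hN hE h0 h1 hi).2⟩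
  have h := mem_Ico_meshIndex (l := l) hN hx'
  have h2 := hs.lt_iff_lt.1 (h.1.trans_lt hx.2)
  have h3 := hs.lt_iff_lt.1 (hx.1.trans_lt h.2)
  omega

/-! ### Bilinear interpolation on one rectangle -/

/-- The bilinear function on `[x₀, x₁] × [y₀, y₁]` with the values of `v` at the four corners. -/
noncomputable def interp (v : ℝ × ℝ → ℝ) (x₀ x₁ y₀ y₁ : ℝ) (p : ℝ × ℝ) : ℝ :=
  ((x₁ - p.1) * ((y₁ - p.2) * v (x₀, y₀) + (p.2 - y₀) * v (x₀, y₁)) +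
    (p.1 - x₀) * ((y₁ - p.2) * v (x₁, y₀) + (p.2 - y₀) * v (x₁, y₁))) / ((x₁ - x₀) * (y₁ - y₀))

/-- The `x`-derivative of `interp v x₀ x₁ y₀ y₁` at height `y`. -/
noncomputable def interpX (v : ℝ × ℝ → ℝ) (x₀ x₁ y₀ y₁ y : ℝ) : ℝ :=
  ((y₁ - y) * (v (x₁, y₀) - v (x₀, y₀)) + (y - y₀) * (v (x₁, y₁) - v (x₀, y₁))) /
    ((x₁ - x₀) * (y₁ - y₀))

lemma hasDerivAt_interp (v : ℝ × ℝ → ℝ) (x₀ x₁ y₀ y₁ x y : ℝ) :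
    HasDerivAt (fun s => interp v x₀ x₁ y₀ y₁ (s, y)) (interpX v x₀ x₁ y₀ y₁ y) x := by
  unfold interp interpX
  have h := ((((hasDerivAt_id x).const_sub x₁).mul_const
    ((y₁ - y) * v (x₀, y₀) + (y - y₀) * v (x₀, y₁))).add (((hasDerivAt_id x).sub_const x₀).mul_const
    ((y₁ - y) * v (x₁, y₀) + (y - y₀) * v (x₁, y₁)))).div_const ((x₁ - x₀) * (y₁ - y₀))
  refine h.congr_deriv ?_
  ring

lemma interp_swap (v : ℝ × ℝ → ℝ) (x₀ x₁ y₀ y₁ : ℝ) (p : ℝ × ℝ) :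
    interp (v ∘ Prod.swap) y₀ y₁ x₀ x₁ p.swap = interp v x₀ x₁ y₀ y₁ p := by
  simp only [interp, Function.comp, Prod.swap_prod_mk, Prod.fst_swap, Prod.snd_swap]
  rw [mul_comm (y₁ - y₀)]
  congr 1
  ring

lemma interp_corner {x₀ x₁ y₀ y₁ : ℝ} (hx : x₀ < x₁) (hy : y₀ < y₁) (v : ℝ × ℝ → ℝ) :
    interp v x₀ x₁ y₀ y₁ (x₀, y₀) = v (x₀, y₀) := by
  have := sub_pos.2 hx
  have := sub_pos.2 hy
  simp only [interp]
  field_simp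
  ring

/-- A bilinear function is its own interpolant. -/
lemma interp_eq_of_bilinear {x₀ x₁ y₀ y₁ : ℝ} (hx : x₀ < x₁) (hy : y₀ < y₁) {u v : ℝ × ℝ → ℝ}
    {a₀ a₁ a₂ a₃ : ℝ}
    (hv : ∀ p ∈ Icc x₀ x₁ ×ˢ Icc y₀ y₁, v p = a₀ + a₁ * p.1 + a₂ * p.2 + a₃ * (p.1 * p.2))
    (h₀₀ : v (x₀, y₀) = u (x₀, y₀)) (h₀₁ : v (x₀, y₁) = u (x₀, y₁))
    (h₁₀ : v (x₁, y₀) = u (x₁, y₀)) (h₁₁ : v (x₁, y₁) = u (x₁, y₁))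
    {p : ℝ × ℝ} (hp : p ∈ Icc x₀ x₁ ×ˢ Icc y₀ y₁) : v p = interp u x₀ x₁ y₀ y₁ p := by
  have hx' := sub_pos.2 hx
  have hy' := sub_pos.2 hy
  have mx₀ : x₀ ∈ Icc x₀ x₁ := left_mem_Icc.2 hx.le
  have mx₁ : x₁ ∈ Icc x₀ x₁ := right_mem_Icc.2 hx.le
  have my₀ : y₀ ∈ Icc y₀ y₁ := left_mem_Icc.2 hy.le
  have my₁ : y₁ ∈ Icc y₀ y₁ := right_mem_Icc.2 hy.le
  rw [interp, ← h₀₀, ← h₀₁, ← h₁₀, ← h₁₁, hv p hp, hv _ (mk_mem_prod mx₀ my₀),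
    hv _ (mk_mem_prod mx₀ my₁), hv _ (mk_mem_prod mx₁ my₀), hv _ (mk_mem_prod mx₁ my₁)]
  field_simp
  ring

lemma abs_interp_le {x₀ x₁ y₀ y₁ B : ℝ} (hx : x₀ < x₁) (hy : y₀ < y₁) {v : ℝ × ℝ → ℝ}
    (hB : ∀ p ∈ Icc x₀ x₁ ×ˢ Icc y₀ y₁, |v p| ≤ B) {p : ℝ × ℝ}
    (hp : p ∈ Icc x₀ x₁ ×ˢ Icc y₀ y₁) : |interp v x₀ x₁ y₀ y₁ p| ≤ B := by
  have hx' := sub_pos.2 hx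
  have hy' := sub_pos.2 hy
  obtain ⟨⟨h1, h2⟩, h3, h4⟩ := hp
  have mx₀ : x₀ ∈ Icc x₀ x₁ := left_mem_Icc.2 hx.le
  have mx₁ : x₁ ∈ Icc x₀ x₁ := right_mem_Icc.2 hx.le
  have my₀ : y₀ ∈ Icc y₀ y₁ := left_mem_Icc.2 hy.le
  have my₁ : y₁ ∈ Icc y₀ y₁ := right_mem_Icc.2 hy.le
  have key : ∀ {a b s t : ℝ}, 0 ≤ s → 0 ≤ t → ∀ {A : ℝ}, |a| ≤ A → |b| ≤ A →
      |s * a + t * b| ≤ (s + t) * A := by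
    intro a b s t hs ht A ha hb
    calc |s * a + t * b| ≤ |s * a| + |t * b| := abs_add_le _ _
      _ = s * |a| + t * |b| := by rw [abs_mul, abs_mul, abs_of_nonneg hs, abs_of_nonneg ht]
      _ ≤ s * A + t * A := by gcongr
      _ = (s + t) * A := by ring
  rw [interp, abs_div, abs_of_pos (mul_pos hx' hy'), div_le_iff₀ (mul_pos hx' hy')]
  refine (key (sub_nonneg.2 h2) (sub_nonneg.2 h1)
    (key (sub_nonneg.2 h4) (sub_nonneg.2 h3) (hB _ (mk_mem_prod mx₀ my₀))
      (hB _ (mk_mem_prod mx₀ my₁)))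
    (key (sub_nonneg.2 h4) (sub_nonneg.2 h3) (hB _ (mk_mem_prod mx₁ my₀))
      (hB _ (mk_mem_prod mx₁ my₁)))).trans (le_of_eq ?_)
  ring

/-- `interpX` is a convex combination of the two difference quotients along the horizontal edges. -/
lemma abs_interpX_sub_le {x₀ x₁ y₀ y₁ y B d : ℝ} (hx : x₀ < x₁) (hy : y ∈ Ico y₀ y₁)
    {v : ℝ × ℝ → ℝ} (h₀ : |v (x₁, y₀) - v (x₀, y₀) - (x₁ - x₀) * d| ≤ (x₁ - x₀) * B)
    (h₁ : |v (x₁, y₁) - v (x₀, y₁) - (x₁ - x₀) * d| ≤ (x₁ - x₀) * B) :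
    |interpX v x₀ x₁ y₀ y₁ y - d| ≤ B := by
  have hx' := sub_pos.2 hx
  have hy' := sub_pos.2 (hy.1.trans_lt hy.2)
  have e : interpX v x₀ x₁ y₀ y₁ y - d =
      ((y₁ - y) * (v (x₁, y₀) - v (x₀, y₀) - (x₁ - x₀) * d) +
        (y - y₀) * (v (x₁, y₁) - v (x₀, y₁) - (x₁ - x₀) * d)) / ((x₁ - x₀) * (y₁ - y₀)) := by
    unfold interpX; field_simp; ring
  rw [e, abs_div, abs_of_pos (mul_pos hx' hy'), div_le_iff₀ (mul_pos hx' hy')]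
  refine (abs_add_le _ _).trans ?_
  rw [abs_mul, abs_mul, abs_of_nonneg (sub_nonneg.2 hy.1), abs_of_nonneg (sub_nonneg.2 hy.2.le)]
  have := mul_le_mul_of_nonneg_left h₀ (sub_nonneg.2 hy.2.le)
  have := mul_le_mul_of_nonneg_left h₁ (sub_nonneg.2 hy.1)
  linarith

lemma abs_interpX_le_of_abs_le {x₀ x₁ y₀ y₁ y B : ℝ} (hx : x₀ < x₁) (hy : y ∈ Ico y₀ y₁)
    {v : ℝ × ℝ → ℝ} (hB : ∀ p ∈ Icc x₀ x₁ ×ˢ Icc y₀ y₁, |v p| ≤ B) :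
    |interpX v x₀ x₁ y₀ y₁ y| ≤ 2 * B / (x₁ - x₀) := by
  have hx' := sub_pos.2 hx
  have hy' := hy.1.trans hy.2.le
  have key : ∀ t ∈ Icc y₀ y₁,
      |v (x₁, t) - v (x₀, t) - (x₁ - x₀) * 0| ≤ (x₁ - x₀) * (2 * B / (x₁ - x₀)) := by
    intro t ht
    rw [mul_div_cancel₀ _ hx'.ne', mul_zero, sub_zero]
    refine (abs_sub _ _).trans ?_
    linarith [hB _ (mk_mem_prod (right_mem_Icc.2 hx.le) ht),
      hB _ (mk_mem_prod (left_mem_Icc.2 hx.le) ht)]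
  simpa using abs_interpX_sub_le hx hy (key _ (left_mem_Icc.2 hy')) (key _ (right_mem_Icc.2 hy'))

/-! ### Functions with bounded partial derivatives on the unit square -/

lemma HasPartials.mono {A A' : ℕ → ℕ → Prop} {v : ℝ × ℝ → ℝ} {D : ℕ → ℕ → ℝ × ℝ → ℝ}
    (h : HasPartials A v D) (hA : ∀ i j, A' i j → A i j) : HasPartials A' v D :=
  ⟨h.zero, fun i j hij => h.dx i j (hA _ _ hij), fun i j hij => h.dy i j (hA _ _ hij)⟩

lemma swap_mem_OmegaBar {p : ℝ × ℝ} (hp : p ∈ OmegaBar) : p.swap ∈ OmegaBar := ⟨hp.2, hp.1⟩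

lemma HasPartials.swap {A : ℕ → ℕ → Prop} {v : ℝ × ℝ → ℝ} {D : ℕ → ℕ → ℝ × ℝ → ℝ}
    (h : HasPartials A v D) :
    HasPartials (fun i j => A j i) (v ∘ Prod.swap) (fun i j => D j i ∘ Prod.swap) :=
  ⟨fun p hp => h.zero p.swap (swap_mem_OmegaBar hp),
    fun i j hij p hp => h.dy j i hij p.swap (swap_mem_OmegaBar hp),
    fun i j hij p hp => h.dx j i hij p.swap (swap_mem_OmegaBar hp)⟩

lemma abs_sub_le_of_hasDerivWithinAt {f f' : ℝ → ℝ} {a b B x x' : ℝ}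
    (hab : Icc a b ⊆ Icc 0 1) (hf : ∀ s ∈ Icc (0 : ℝ) 1, HasDerivWithinAt f (f' s) (Icc 0 1) s)
    (hB : ∀ s ∈ Icc a b, |f' s| ≤ B) (hx : x ∈ Icc a b) (hx' : x' ∈ Icc a b) :
    |f x' - f x| ≤ (b - a) * B := by
  have h := (convex_Icc a b).norm_image_sub_le_of_norm_hasDerivWithin_le
    (fun s hs => (hf s (hab hs)).mono hab) hB hx hx'
  have hB0 : 0 ≤ B := (abs_nonneg _).trans (hB x hx)
  have : ‖x' - x‖ ≤ b - a := by
    rw [Real.norm_eq_abs, abs_le]; constructor <;> linarith [hx.1, hx.2, hx'.1, hx'.2]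
  calc |f x' - f x| ≤ B * ‖x' - x‖ := h
    _ ≤ B * (b - a) := by gcongr
    _ = _ := mul_comm _ _

section Rectangle

variable {v : ℝ × ℝ → ℝ} {D : ℕ → ℕ → ℝ × ℝ → ℝ} {x₀ x₁ y₀ y₁ : ℝ}

/-- `H¹`-type stability of interpolation, in the maximum norm. -/
lemma abs_interpX_le_of_partial (h : HasPartials (fun i j => i + j ≤ 2) v D)
    (hx : x₀ < x₁) (hX : Icc x₀ x₁ ⊆ Icc 0 1) (hY : Icc y₀ y₁ ⊆ Icc 0 1) {B y : ℝ}
    (hB : ∀ p ∈ Icc x₀ x₁ ×ˢ Icc y₀ y₁, |D 1 0 p| ≤ B) (hy : y ∈ Ico y₀ y₁) :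
    |interpX v x₀ x₁ y₀ y₁ y| ≤ B := by
  have hy' := hy.1.trans hy.2.le
  have key : ∀ t ∈ Icc y₀ y₁, |v (x₁, t) - v (x₀, t) - (x₁ - x₀) * 0| ≤ (x₁ - x₀) * B := by
    intro t ht
    rw [mul_zero, sub_zero, ← h.zero (x₁, t) ⟨hX (right_mem_Icc.2 hx.le), hY ht⟩,
      ← h.zero (x₀, t) ⟨hX (left_mem_Icc.2 hx.le), hY ht⟩]
    exact abs_sub_le_of_hasDerivWithinAt (f := fun s => D 0 0 (s, t)) hX
      (fun s hs => h.dx 0 0 (by norm_num) (s, t) ⟨hs, hY ht⟩)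
      (fun s hs => hB _ (mk_mem_prod hs ht)) (left_mem_Icc.2 hx.le) (right_mem_Icc.2 hx.le)
  simpa using abs_interpX_sub_le hx hy (key _ (left_mem_Icc.2 hy')) (key _ (right_mem_Icc.2 hy'))

/-- First-order estimate for the `x`-derivative of the interpolation error. -/
lemma abs_partial_sub_interpX_le (h : HasPartials (fun i j => i + j ≤ 2) v D)
    (hx : x₀ < x₁) (hX : Icc x₀ x₁ ⊆ Icc 0 1) (hY : Icc y₀ y₁ ⊆ Icc 0 1) {B₂₀ B₁₁ : ℝ}
    (hB₂₀ : ∀ p ∈ Icc x₀ x₁ ×ˢ Icc y₀ y₁, |D 2 0 p| ≤ B₂₀)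
    (hB₁₁ : ∀ p ∈ Icc x₀ x₁ ×ˢ Icc y₀ y₁, |D 1 1 p| ≤ B₁₁)
    {p : ℝ × ℝ} (hp : p ∈ Icc x₀ x₁ ×ˢ Ico y₀ y₁) :
    |D 1 0 p - interpX v x₀ x₁ y₀ y₁ p.2| ≤ (x₁ - x₀) * B₂₀ + (y₁ - y₀) * B₁₁ := by
  have hy := hp.2
  have hy' := hy.1.trans hy.2.le
  have hpc : p.2 ∈ Icc y₀ y₁ := Ico_subset_Icc_self hy
  have key : ∀ t ∈ Icc y₀ y₁, |v (x₁, t) - v (x₀, t) - (x₁ - x₀) * D 1 0 p| ≤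
      (x₁ - x₀) * ((x₁ - x₀) * B₂₀ + (y₁ - y₀) * B₁₁) := by
    intro t ht
    rw [← h.zero (x₁, t) ⟨hX (right_mem_Icc.2 hx.le), hY ht⟩,
      ← h.zero (x₀, t) ⟨hX (left_mem_Icc.2 hx.le), hY ht⟩]
    have := abs_sub_le_of_hasDerivWithinAt (f := fun s => D 0 0 (s, t) - s * D 1 0 p)
      (f' := fun s => D 1 0 (s, t) - 1 * D 1 0 p) (B := (x₁ - x₀) * B₂₀ + (y₁ - y₀) * B₁₁) hX
      (fun s hs => (h.dx 0 0 (by norm_num) (s, t) ⟨hs, hY ht⟩).sub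
        ((hasDerivWithinAt_id s _).mul_const _))
      (fun s hs => ?_) (left_mem_Icc.2 hx.le) (right_mem_Icc.2 hx.le)
    · refine le_trans (le_of_eq ?_) this
      congr 1; ring
    · have e₁ := abs_sub_le_of_hasDerivWithinAt (f := fun s => D 1 0 (s, t)) hX
        (fun s hs => h.dx 1 0 (by norm_num) (s, t) ⟨hs, hY ht⟩)
        (fun s hs => hB₂₀ _ (mk_mem_prod hs ht)) hp.1 hs
      have e₂ := abs_sub_le_of_hasDerivWithinAt (f := fun r => D 1 0 (p.1, r)) hY
        (fun s hs => h.dy 1 0 (by norm_num) (p.1, s) ⟨hX hp.1, hs⟩)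
        (fun s hs => hB₁₁ _ (mk_mem_prod hp.1 hs)) hpc ht
      rw [one_mul, show D 1 0 (s, t) - D 1 0 p =
        (D 1 0 (s, t) - D 1 0 (p.1, t)) + (D 1 0 (p.1, t) - D 1 0 (p.1, p.2)) by ring]
      exact (abs_add_le _ _).trans (add_le_add e₁ e₂)
  rw [abs_sub_comm]
  exact abs_interpX_sub_le hx hy (key _ (left_mem_Icc.2 hy')) (key _ (right_mem_Icc.2 hy'))

/-- The interpolation error is controlled by its own first derivatives, since it vanishes at a
corner. -/
lemma abs_sub_interp_le (h : HasPartials (fun i j => i + j ≤ 2) v D)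
    (hx : x₀ < x₁) (hy : y₀ < y₁) (hX : Icc x₀ x₁ ⊆ Icc 0 1) (hY : Icc y₀ y₁ ⊆ Icc 0 1)
    {Bx By : ℝ}
    (hBx : ∀ p ∈ Icc x₀ x₁ ×ˢ Ico y₀ y₁, |D 1 0 p - interpX v x₀ x₁ y₀ y₁ p.2| ≤ Bx)
    (hBy : ∀ p ∈ Ico x₀ x₁ ×ˢ Icc y₀ y₁,
      |D 0 1 p - interpX (v ∘ Prod.swap) y₀ y₁ x₀ x₁ p.1| ≤ By)
    {p : ℝ × ℝ} (hp : p ∈ Ico x₀ x₁ ×ˢ Ico y₀ y₁) :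
    |v p - interp v x₀ x₁ y₀ y₁ p| ≤ (x₁ - x₀) * Bx + (y₁ - y₀) * By := by
  have hp1 : p.1 ∈ Icc x₀ x₁ := Ico_subset_Icc_self hp.1
  have hp2 : p.2 ∈ Icc y₀ y₁ := Ico_subset_Icc_self hp.2
  have l0 := left_mem_Icc.2 hx.le
  have m0 := left_mem_Icc.2 hy.le
  have e₁ := abs_sub_le_of_hasDerivWithinAt
    (f := fun s => D 0 0 (s, p.2) - interp v x₀ x₁ y₀ y₁ (s, p.2))
    (f' := fun s => D 1 0 (s, p.2) - interpX v x₀ x₁ y₀ y₁ p.2) hX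
    (fun s hs => (h.dx 0 0 (by norm_num) (s, p.2) ⟨hs, hY hp2⟩).sub
      (hasDerivAt_interp v x₀ x₁ y₀ y₁ s p.2).hasDerivWithinAt)
    (fun s hs => hBx (s, p.2) ⟨hs, hp.2⟩) l0 hp1
  have e₂ := abs_sub_le_of_hasDerivWithinAt
    (f := fun t => D 0 0 (x₀, t) - interp (v ∘ Prod.swap) y₀ y₁ x₀ x₁ (t, x₀))
    (f' := fun t => D 0 1 (x₀, t) - interpX (v ∘ Prod.swap) y₀ y₁ x₀ x₁ x₀) hY
    (fun t ht => (h.dy 0 0 (by norm_num) (x₀, t) ⟨hX l0, ht⟩).sub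
      (hasDerivAt_interp (v ∘ Prod.swap) y₀ y₁ x₀ x₁ t x₀).hasDerivWithinAt)
    (fun t ht => hBy (x₀, t) ⟨left_mem_Ico.2 hx, ht⟩) m0 hp2
  have s₁ := interp_swap v x₀ x₁ y₀ y₁ (x₀, p.2)
  have s₂ := interp_swap v x₀ x₁ y₀ y₁ (x₀, y₀)
  rw [interp_corner hx hy] at s₂
  simp only [Prod.swap_prod_mk] at s₁ s₂
  simp only [s₁, s₂] at e₂
  rw [h.zero (x₀, y₀) ⟨hX l0, hY m0⟩, sub_self, sub_zero] at e₂
  rw [← h.zero p ⟨hX hp1, hY hp2⟩]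
  refine le_trans (le_of_eq ?_) ((abs_add_le _ _).trans (add_le_add e₁ e₂))
  congr 1
  ring

end Rectangle

/-! ### Exponential layers on the Shishkin mesh -/

/-- The boundary layer function `exp(-β (1 - x) / ε)`. -/
noncomputable def layer (ε β x : ℝ) : ℝ := Real.exp (-(β * (1 - x)) / ε)

/-- The convergence rate `N⁻¹ ln N` of the energy norm. -/
noncomputable def rate (N : ℕ) : ℝ := Real.log N / N

/-- The parameters of the Shishkin mesh in one direction, in the regime `ε ≤ N⁻¹`. -/
structure IsMesh (ε β l : ℝ) (N : ℕ) : Prop where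
  pos : 0 < N
  even : Even N
  eps_pos : 0 < ε
  eps_le : ε ≤ (N : ℝ)⁻¹
  beta_pos : 0 < β
  width : l = layerWidth ε β N
  lt_one : l < 1

lemma layer_pos (ε β x : ℝ) : 0 < layer ε β x := Real.exp_pos _

namespace IsMesh

variable {ε β l : ℝ} {N : ℕ} (h : IsMesh ε β l N)
include h

lemma two_le : 2 ≤ N := by
  obtain ⟨m, hm⟩ := h.even
  have := h.pos
  omega

lemma natCast_pos : (0 : ℝ) < N := by exact_mod_cast h.pos

lemma half_le_log : 1 / 2 ≤ Real.log N := by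
  have h2 : (2 : ℝ) ≤ N := by exact_mod_cast h.two_le
  have := Real.log_le_log (by norm_num) h2
  linarith [Real.log_two_gt_d9]

/-- The factor `2` absorbs `ln 2 < 1`. -/
lemma inv_le_rate : 1 / (N : ℝ) ≤ 2 * rate N := by
  have := h.natCast_pos
  have := h.half_le_log
  rw [rate, ← mul_div_assoc]; gcongr; linarith

lemma rate_nonneg : 0 ≤ rate N := by
  have := h.natCast_pos
  have := h.half_le_log
  unfold rate; positivity

lemma rate_le_one : rate N ≤ 1 := by
  have := h.natCast_pos
  rw [rate, div_le_one this]
  linarith [Real.log_le_sub_one_of_pos this]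

lemma inv_sq_le_inv : 1 / (N : ℝ) ^ 2 ≤ 1 / N := by
  have := h.natCast_pos
  have h2 : (2 : ℝ) ≤ N := by exact_mod_cast h.two_le
  gcongr
  nlinarith

lemma width_pos : 0 < l := by
  have := h.eps_pos
  have := h.beta_pos
  have := h.half_le_log
  rw [h.width, layerWidth]; positivity

lemma node_lt (i : ℕ) : node l N i < node l N (i + 1) :=
  node_lt_succ h.pos h.even h.width_pos h.lt_one i

lemma step_le (i : ℕ) : node l N (i + 1) - node l N i ≤ 2 / N :=
  node_succ_sub_le h.pos h.even h.width_pos h.lt_one i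

lemma Icc_node_subset {i : ℕ} (hi : i < N) : Icc (node l N i) (node l N (i + 1)) ⊆ Icc 0 1 :=
  Icc_subset_Icc (node_mem_Icc h.pos h.even h.width_pos h.lt_one hi.le).1
    (node_mem_Icc h.pos h.even h.width_pos h.lt_one hi).2

lemma meshIndex_coarse_iff {x : ℝ} (hx : x ∈ Ico (0 : ℝ) 1) :
    2 * meshIndex l N x < N ↔ x < 1 - l := by
  have hm := mem_Ico_meshIndex (l := l) h.pos hx
  constructor
  · intro hlt
    refine hm.2.trans_le (node_le_transition h.pos h.even h.width_pos h.lt_one ?_)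
    obtain ⟨m, hm⟩ := h.even
    omega
  · intro hlt
    by_contra! hge
    exact absurd hlt (not_lt.2
      ((transition_le_node h.pos h.even h.width_pos h.lt_one hge).trans hm.1))

lemma step_fine {i : ℕ} (hi : N ≤ 2 * i) :
    node l N (i + 1) - node l N i = 5 / β * ε * rate N := by
  rw [node_succ_sub_of_ge h.pos hi, h.width, layerWidth, rate]
  ring

lemma step_le_rate (i : ℕ) : node l N (i + 1) - node l N i ≤ 4 * rate N := by
  have h1 := h.step_le i
  have h2 := h.inv_le_rate
  rw [← mul_one_div] at h1
  linarith

lemma layer_mono {x y : ℝ} (hxy : x ≤ y) : layer ε β x ≤ layer ε β y := by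
  have := h.eps_pos
  have := h.beta_pos
  unfold layer
  gcongr

lemma layer_le_one {x : ℝ} (hx : x ≤ 1) : layer ε β x ≤ 1 := by
  refine (h.layer_mono hx).trans (le_of_eq ?_)
  simp [layer]

lemma beta_mul_width_div : β * l / ε = 5 / 2 * Real.log N := by
  have := h.eps_pos
  have := h.beta_pos
  rw [h.width, layerWidth]; field_simp

/-- Outside the layer region the boundary layer function is as small as `N^{-5/2}`. -/
lemma layer_transition_le : layer ε β (1 - l) ≤ 1 / (N : ℝ) ^ 2 := by
  have hN := h.natCast_pos
  have hl := h.half_le_log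
  have e : -(β * (1 - (1 - l))) / ε = -(5 / 2 * Real.log N) := by
    rw [← h.beta_mul_width_div]; ring
  rw [layer, e, one_div, ← Real.exp_log (pow_pos hN 2), ← Real.exp_neg, Real.log_pow]
  apply Real.exp_le_exp.2
  push_cast; linarith

lemma layer_coarse_le {x : ℝ} (hx : x ≤ 1 - l) : layer ε β x ≤ 1 / (N : ℝ) ^ 2 :=
  (h.layer_mono hx).trans h.layer_transition_le

/-- The layer function is negligible on the coarse mesh intervals. -/
lemma layer_le_of_coarse {i : ℕ} (hi : 2 * i < N) {s : ℝ} (hs : s ≤ node l N (i + 1)) :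
    layer ε β s ≤ 1 / (N : ℝ) ^ 2 := by
  refine h.layer_coarse_le
    (hs.trans (node_le_transition h.pos h.even h.width_pos h.lt_one ?_))
  obtain ⟨m, hm⟩ := h.even
  omega

/-- On one fine mesh interval the layer function varies at most by a bounded factor. -/
lemma layer_le_of_fine {i : ℕ} (hi : N ≤ 2 * i) {x s : ℝ}
    (hx : x ∈ Icc (node l N i) (node l N (i + 1))) (hs : s ∈ Icc (node l N i) (node l N (i + 1))) :
    layer ε β s ≤ Real.exp 5 * layer ε β x := by
  have hε := h.eps_pos
  have hβ := h.beta_pos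
  rw [layer, layer, ← Real.exp_add]
  apply Real.exp_le_exp.2
  have h1 : s - x ≤ 5 / β * ε * rate N := by rw [← h.step_fine hi]; linarith [hs.2, hx.1]
  have h2 : β * (s - x) / ε ≤ 5 := by
    calc β * (s - x) / ε ≤ β * (5 / β * ε * rate N) / ε := by gcongr
      _ = 5 * rate N := by field_simp
      _ ≤ 5 := by linarith [h.rate_le_one]
  have : -(β * (1 - s)) / ε = β * (s - x) / ε + -(β * (1 - x)) / ε := by ring
  linarith

/-- If the coarse part of the mesh is short, then `ε` is comparable to `1 / ln N`. -/
lemma inv_eps_le (hl : 1 / 2 ≤ l) : ε⁻¹ ≤ 5 / β * Real.log N := by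
  have hε := h.eps_pos
  have hβ := h.beta_pos
  have e : l = 5 / 2 * (1 / β) * Real.log N * ε := by rw [h.width, layerWidth]; ring
  rw [inv_le_iff_one_le_mul₀ hε]
  have : 5 / β * Real.log N * ε = 2 * l := by rw [e]; ring
  linarith

end IsMesh

/-! ### Pointwise interpolation error bounds on one mesh rectangle -/

/-- The constant in the pointwise interpolation error estimates. The factor `e⁵` bounds the
oscillation of the layer functions on a fine cell. -/
noncomputable def errConst (β₁ β₂ M : ℝ) : ℝ := M * Real.exp 5 * (20 + 10 / β₁ + 10 / β₂)

lemma errConst_comm (β₁ β₂ M : ℝ) : errConst β₁ β₂ M = errConst β₂ β₁ M := by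
  unfold errConst; ring

lemma exp_mul_le_errConst {β₁ β₂ M t : ℝ} (hM : 0 < M) (ht : t ≤ 20 + 10 / β₁ + 10 / β₂) :
    M * Real.exp 5 * t ≤ errConst β₁ β₂ M := by
  have := Real.exp_pos 5
  unfold errConst; gcongr

lemma mul_le_errConst {β₁ β₂ M t : ℝ} (hM : 0 < M) (h0 : 0 ≤ t)
    (ht : t ≤ 20 + 10 / β₁ + 10 / β₂) : M * t ≤ errConst β₁ β₂ M := by
  have := Real.one_le_exp (x := 5) (by norm_num)
  refine le_trans ?_ (exp_mul_le_errConst hM ht)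
  have : M * 1 ≤ M * Real.exp 5 := by gcongr
  calc M * t = M * 1 * t := by ring
    _ ≤ _ := by gcongr

section Cell

variable {ε β₁ β₂ lx ly M : ℝ} {N : ℕ} (hx : IsMesh ε β₁ lx N) (hy : IsMesh ε β₂ ly N)
  (hM : 0 < M) {i j : ℕ} (hi : i < N) (hj : j < N)
  {v : ℝ × ℝ → ℝ} {D : ℕ → ℕ → ℝ × ℝ → ℝ} (hD : HasPartials (fun i j => i + j ≤ 2) v D)
include hx hy hi hj

lemma cell_subset_OmegaBar : cell lx ly N i j ⊆ OmegaBar :=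
  prod_mono (hx.Icc_node_subset hi) (hy.Icc_node_subset hj)

include hM hD

lemma regular_partial_error (hB : ∀ i j, i + j ≤ 2 → ∀ p ∈ OmegaBar, |D i j p| ≤ M) {p : ℝ × ℝ}
    (hp : p ∈ Icc (node lx N i) (node lx N (i + 1)) ×ˢ Ico (node ly N j) (node ly N (j + 1))) :
    |D 1 0 p - interpX v (node lx N i) (node lx N (i + 1)) (node ly N j) (node ly N (j + 1)) p.2|
      ≤ 4 * M * (1 / N) := by
  have hsub := cell_subset_OmegaBar hx hy hi hj
  refine (abs_partial_sub_interpX_le hD (hx.node_lt i) (hx.Icc_node_subset hi)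
    (hy.Icc_node_subset hj) (fun q hq => hB 2 0 (by norm_num) q (hsub hq))
    (fun q hq => hB 1 1 (by norm_num) q (hsub hq)) hp).trans ?_
  have h1 := mul_le_mul_of_nonneg_right (hx.step_le i) hM.le
  have h2 := mul_le_mul_of_nonneg_right (hy.step_le j) hM.le
  refine (add_le_add h1 h2).trans (le_of_eq ?_)
  ring

/-- On coarse cells the interpolant of a layer function has a small gradient: by the size of the
function if the cell is not too short, by the size of its derivative otherwise. -/
lemma layer_partial_error_coarse (hc : 2 * i < N)
    (hB₀ : ∀ p ∈ OmegaBar, |v p| ≤ M * layer ε β₁ p.1)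
    (hB₁ : ∀ p ∈ OmegaBar, |D 1 0 p| ≤ M * ε⁻¹ * layer ε β₁ p.1) {p : ℝ × ℝ}
    (hp : p ∈ Icc (node lx N i) (node lx N (i + 1)) ×ˢ Ico (node ly N j) (node ly N (j + 1))) :
    |D 1 0 p - interpX v (node lx N i) (node lx N (i + 1)) (node ly N j) (node ly N (j + 1)) p.2|
      ≤ errConst β₁ β₂ M * (1 / N + ε⁻¹ * layer ε β₁ p.1) := by
  have hsub := cell_subset_OmegaBar hx hy hi hj
  have hN := hx.natCast_pos
  have hε := hx.eps_pos
  have hβ₁ := hx.beta_pos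
  have hβ₂ := hy.beta_pos
  have hw : ∀ q ∈ cell lx ly N i j, layer ε β₁ q.1 ≤ 1 / (N : ℝ) ^ 2 := fun q hq =>
    hx.layer_le_of_coarse hc hq.1.2
  have hI : |interpX v (node lx N i) (node lx N (i + 1)) (node ly N j) (node ly N (j + 1)) p.2|
      ≤ M * (2 + 5 / β₁) * (1 / N) := by
    rcases le_total lx (1 / 2) with hl | hl
    · have hstep : 1 / (N : ℝ) ≤ node lx N (i + 1) - node lx N i := by
        rw [node_succ_sub_of_lt hx.even hc]; gcongr; linarith
      refine (abs_interpX_le_of_abs_le (hx.node_lt i) hp.2 (B := M * (1 / (N : ℝ) ^ 2))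
        fun q hq => (hB₀ q (hsub hq)).trans (by gcongr; exact hw q hq)).trans ?_
      calc 2 * (M * (1 / (N : ℝ) ^ 2)) / (node lx N (i + 1) - node lx N i)
          ≤ 2 * (M * (1 / (N : ℝ) ^ 2)) / (1 / N) := by gcongr
        _ = M * 2 * (1 / N) := by field_simp
        _ ≤ _ := by gcongr; linarith [show 0 < 5 / β₁ by positivity]
    · refine (abs_interpX_le_of_partial hD (hx.node_lt i) (hx.Icc_node_subset hi)
        (hy.Icc_node_subset hj) (B := M * (5 / β₁ * Real.log N) * (1 / (N : ℝ) ^ 2))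
        (fun q hq => (hB₁ q (hsub hq)).trans ?_) hp.2).trans ?_
      · have := hx.half_le_log
        gcongr
        · exact (layer_pos _ _ _).le
        · exact hx.inv_eps_le hl
        · exact hw q hq
      · have hr := hx.rate_le_one
        have : M * (5 / β₁ * Real.log N) * (1 / (N : ℝ) ^ 2) = M * (5 / β₁ * rate N) * (1 / N) := by
          rw [rate]; field_simp
        rw [this]
        gcongr
        have : 5 / β₁ * rate N ≤ 5 / β₁ * 1 := by gcongr
        linarith
  have hD1 := hB₁ p (hsub ⟨hp.1, Ico_subset_Icc_self hp.2⟩)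
  have k1 : M * (2 + 5 / β₁) ≤ errConst β₁ β₂ M := mul_le_errConst hM (by positivity) (by
    have h1 : 0 < 1 / β₁ := by positivity
    have h2 : 0 < 10 / β₂ := by positivity
    rw [div_eq_mul_one_div 5, div_eq_mul_one_div 10]; linarith)
  have k2 : M ≤ errConst β₁ β₂ M := by
    have := mul_le_errConst (β₁ := β₁) (β₂ := β₂) hM zero_le_one (by
      have h1 : 0 < 10 / β₁ := by positivity
      have h2 : 0 < 10 / β₂ := by positivity
      linarith)
    linarith
  have hl := layer_pos ε β₁ p.1
  calc _ ≤ M * ε⁻¹ * layer ε β₁ p.1 + M * (2 + 5 / β₁) * (1 / N) :=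
        (abs_sub _ _).trans (add_le_add hD1 hI)
    _ ≤ errConst β₁ β₂ M * ε⁻¹ * layer ε β₁ p.1 + errConst β₁ β₂ M * (1 / N) := by gcongr
    _ = _ := by ring

/-- The step `(5 / β₁) ε N⁻¹ ln N` of the fine mesh compensates the additional factor `ε⁻¹` of the
second derivative, up to `rate N`. -/
lemma layer₁_partial_error_fine (hf : N ≤ 2 * i)
    (hB : ∀ i j, i + j ≤ 2 → ∀ p ∈ OmegaBar, |D i j p| ≤ M * (ε ^ i)⁻¹ * layer ε β₁ p.1)
    {p : ℝ × ℝ}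
    (hp : p ∈ Icc (node lx N i) (node lx N (i + 1)) ×ˢ Ico (node ly N j) (node ly N (j + 1))) :
    |D 1 0 p - interpX v (node lx N i) (node lx N (i + 1)) (node ly N j) (node ly N (j + 1)) p.2|
      ≤ errConst β₁ β₂ M * (rate N * (ε⁻¹ * layer ε β₁ p.1)) := by
  have hsub := cell_subset_OmegaBar hx hy hi hj
  have hε := hx.eps_pos
  have hβ₁ := hx.beta_pos
  have hβ₂ := hy.beta_pos
  have hr := hx.rate_nonneg
  have hl := layer_pos ε β₁ p.1
  refine (abs_partial_sub_interpX_le hD (hx.node_lt i) (hx.Icc_node_subset hi)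
    (hy.Icc_node_subset hj) (B₂₀ := M * (ε ^ 2)⁻¹ * (Real.exp 5 * layer ε β₁ p.1))
    (B₁₁ := M * (ε ^ 1)⁻¹ * (Real.exp 5 * layer ε β₁ p.1))
    (fun q hq => (hB 2 0 (by norm_num) q (hsub hq)).trans ?_)
    (fun q hq => (hB 1 1 (by norm_num) q (hsub hq)).trans ?_) hp).trans ?_
  · gcongr; exact hx.layer_le_of_fine hf hp.1 hq.1
  · gcongr; exact hx.layer_le_of_fine hf hp.1 hq.1
  · have h1 := hy.step_le_rate j
    rw [hx.step_fine hf]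
    calc _ ≤ 5 / β₁ * ε * rate N * (M * (ε ^ 2)⁻¹ * (Real.exp 5 * layer ε β₁ p.1)) +
          4 * rate N * (M * (ε ^ 1)⁻¹ * (Real.exp 5 * layer ε β₁ p.1)) := by gcongr
      _ = M * Real.exp 5 * (5 / β₁ + 4) * (rate N * (ε⁻¹ * layer ε β₁ p.1)) := by
        field_simp
      _ ≤ _ := by
        gcongr
        refine exp_mul_le_errConst hM ?_
        have h1 : 0 < 1 / β₁ := by positivity
        have h2 : 0 < 10 / β₂ := by positivity
        rw [div_eq_mul_one_div 5, div_eq_mul_one_div 10]; linarith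

lemma layer₂_partial_error_coarse (hc : 2 * j < N)
    (hB : ∀ i j, i + j ≤ 2 → ∀ p ∈ OmegaBar, |D i j p| ≤ M * (ε ^ j)⁻¹ * layer ε β₂ p.2)
    {p : ℝ × ℝ}
    (hp : p ∈ Icc (node lx N i) (node lx N (i + 1)) ×ˢ Ico (node ly N j) (node ly N (j + 1))) :
    |D 1 0 p - interpX v (node lx N i) (node lx N (i + 1)) (node ly N j) (node ly N (j + 1)) p.2|
      ≤ 2 * M * (1 / N) := by
  have hsub := cell_subset_OmegaBar hx hy hi hj
  have hb : ∀ q ∈ cell lx ly N i j, |D 1 0 q| ≤ M * (1 / N) := by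
    intro q hq
    refine (hB 1 0 (by norm_num) q (hsub hq)).trans ?_
    rw [pow_zero, inv_one, mul_one]
    gcongr
    exact (hy.layer_le_of_coarse hc hq.2.2).trans hy.inv_sq_le_inv
  refine (abs_sub _ _).trans ((add_le_add (hb p ⟨hp.1, Ico_subset_Icc_self hp.2⟩)
    (abs_interpX_le_of_partial hD (hx.node_lt i) (hx.Icc_node_subset hi)
        (hy.Icc_node_subset hj) hb hp.2)).trans (le_of_eq ?_))
  ring

/-- The `x`-derivative of the layer along `y = 1`; differentiating in `x` costs no power of `ε`
here. -/
lemma layer₂_partial_error_fine (hf : N ≤ 2 * j)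
    (hB : ∀ i j, i + j ≤ 2 → ∀ p ∈ OmegaBar, |D i j p| ≤ M * (ε ^ j)⁻¹ * layer ε β₂ p.2)
    {p : ℝ × ℝ}
    (hp : p ∈ Icc (node lx N i) (node lx N (i + 1)) ×ˢ Ico (node ly N j) (node ly N (j + 1))) :
    |D 1 0 p - interpX v (node lx N i) (node lx N (i + 1)) (node ly N j) (node ly N (j + 1)) p.2|
      ≤ errConst β₁ β₂ M * rate N := by
  have hsub := cell_subset_OmegaBar hx hy hi hj
  have hε := hx.eps_pos
  have hβ₁ := hx.beta_pos
  have hβ₂ := hy.beta_pos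
  have hr := hx.rate_nonneg
  refine (abs_partial_sub_interpX_le hD (hx.node_lt i) (hx.Icc_node_subset hi)
    (hy.Icc_node_subset hj) (B₂₀ := M * (ε ^ 0)⁻¹ * 1) (B₁₁ := M * (ε ^ 1)⁻¹ * 1)
    (fun q hq => (hB 2 0 (by norm_num) q (hsub hq)).trans ?_)
    (fun q hq => (hB 1 1 (by norm_num) q (hsub hq)).trans ?_) hp).trans ?_
  · gcongr; exact hy.layer_le_one (hsub hq).2.2
  · gcongr; exact hy.layer_le_one (hsub hq).2.2
  · have h1 := hx.step_le_rate i
    rw [hy.step_fine hf]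
    calc _ ≤ 4 * rate N * (M * (ε ^ 0)⁻¹ * 1) + 5 / β₂ * ε * rate N * (M * (ε ^ 1)⁻¹ * 1) := by
          gcongr
      _ = M * (4 + 5 / β₂) * rate N := by field_simp
      _ ≤ _ := by
        gcongr
        refine mul_le_errConst hM (by positivity) ?_
        have h1 : 0 < 1 / β₂ := by positivity
        have h2 : 0 < 10 / β₁ := by positivity
        rw [div_eq_mul_one_div 5 β₂, div_eq_mul_one_div 10 β₂]; linarith

/-- For the corner layer, a coarse cell in the `y`-direction makes the function negligible, and on a
fine cell both step sizes are of order `ε · rate N`. -/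
lemma layer₁₂_partial_error_fine (hf : N ≤ 2 * i)
    (hB : ∀ i j, i + j ≤ 2 → ∀ p ∈ OmegaBar,
      |D i j p| ≤ M * (ε ^ (i + j))⁻¹ * (layer ε β₁ p.1 * layer ε β₂ p.2))
    {p : ℝ × ℝ}
    (hp : p ∈ Icc (node lx N i) (node lx N (i + 1)) ×ˢ Ico (node ly N j) (node ly N (j + 1))) :
    |D 1 0 p - interpX v (node lx N i) (node lx N (i + 1)) (node ly N j) (node ly N (j + 1)) p.2|
      ≤ errConst β₁ β₂ M * (rate N * (ε⁻¹ * layer ε β₁ p.1)) := by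
  have hsub := cell_subset_OmegaBar hx hy hi hj
  have hε := hx.eps_pos
  have hβ₁ := hx.beta_pos
  have hβ₂ := hy.beta_pos
  have hr := hx.rate_nonneg
  have hl := layer_pos ε β₁ p.1
  have hN := hx.natCast_pos
  have a1 : 0 < 1 / β₁ := by positivity
  have a2 : 0 < 1 / β₂ := by positivity
  rcases lt_or_ge (2 * j) N with hc | hc
  · have hb : ∀ q ∈ cell lx ly N i j, |D 1 0 q| ≤
        M * ε⁻¹ * (Real.exp 5 * layer ε β₁ p.1 * (2 * rate N)) := by
      intro q hq
      refine (hB 1 0 (by norm_num) q (hsub hq)).trans ?_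
      rw [show 1 + 0 = 1 from rfl, pow_one]
      gcongr
      · exact (layer_pos _ _ _).le
      · exact hx.layer_le_of_fine hf hp.1 hq.1
      · exact ((hy.layer_le_of_coarse hc hq.2.2).trans hy.inv_sq_le_inv).trans hy.inv_le_rate
    refine (abs_sub _ _).trans ((add_le_add (hb p ⟨hp.1, Ico_subset_Icc_self hp.2⟩)
      (abs_interpX_le_of_partial hD (hx.node_lt i) (hx.Icc_node_subset hi)
          (hy.Icc_node_subset hj) hb hp.2)).trans ?_)
    calc _ = M * Real.exp 5 * 4 * (rate N * (ε⁻¹ * layer ε β₁ p.1)) := by ring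
      _ ≤ _ := by
        gcongr
        refine exp_mul_le_errConst hM ?_
        rw [div_eq_mul_one_div 10, div_eq_mul_one_div 10 β₂]; linarith
  · have hb : ∀ q ∈ cell lx ly N i j,
        layer ε β₁ q.1 * layer ε β₂ q.2 ≤ Real.exp 5 * layer ε β₁ p.1 := by
      intro q hq
      calc layer ε β₁ q.1 * layer ε β₂ q.2 ≤ (Real.exp 5 * layer ε β₁ p.1) * 1 := by
            gcongr
            · exact (layer_pos _ _ _).le
            · exact hx.layer_le_of_fine hf hp.1 hq.1
            · exact hy.layer_le_one (hsub hq).2.2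
        _ = _ := mul_one _
    refine (abs_partial_sub_interpX_le hD (hx.node_lt i) (hx.Icc_node_subset hi)
      (hy.Icc_node_subset hj) (B₂₀ := M * (ε ^ 2)⁻¹ * (Real.exp 5 * layer ε β₁ p.1))
      (B₁₁ := M * (ε ^ 2)⁻¹ * (Real.exp 5 * layer ε β₁ p.1))
      (fun q hq => (hB 2 0 (by norm_num) q (hsub hq)).trans ?_)
      (fun q hq => (hB 1 1 (by norm_num) q (hsub hq)).trans ?_) hp).trans ?_
    · exact mul_le_mul_of_nonneg_left (hb q hq) (by positivity)
    · exact mul_le_mul_of_nonneg_left (hb q hq) (by positivity)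
    · rw [hx.step_fine hf, hy.step_fine hc]
      calc _ = M * Real.exp 5 * (5 / β₁ + 5 / β₂) * (rate N * (ε⁻¹ * layer ε β₁ p.1)) := by
            field_simp
        _ ≤ _ := by
          gcongr
          refine exp_mul_le_errConst hM ?_
          rw [div_eq_mul_one_div 10, div_eq_mul_one_div 10 β₂, div_eq_mul_one_div 5,
            div_eq_mul_one_div 5 β₂]
          linarith

end Cell

lemma HasPartials.swap_le_two {v : ℝ × ℝ → ℝ} {D : ℕ → ℕ → ℝ × ℝ → ℝ}
    (h : HasPartials (fun i j => i + j ≤ 2) v D) :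
    HasPartials (fun i j => i + j ≤ 2) (v ∘ Prod.swap) (fun i j => D j i ∘ Prod.swap) :=
  h.swap.mono fun i j hij => by omega

section CellValue

variable {ε β₁ β₂ lx ly M : ℝ} {N : ℕ} (hx : IsMesh ε β₁ lx N) (hy : IsMesh ε β₂ ly N)
  {i j : ℕ} (hi : i < N) (hj : j < N) {v : ℝ × ℝ → ℝ} {D : ℕ → ℕ → ℝ × ℝ → ℝ}
include hx hy

/-- Where the function itself is small, the error is bounded by the triangle inequality. -/
lemma small_value_error {B : ℝ} (hB : ∀ q ∈ cell lx ly N i j, |v q| ≤ B) {p : ℝ × ℝ}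
    (hp : p ∈ Ico (node lx N i) (node lx N (i + 1)) ×ˢ Ico (node ly N j) (node ly N (j + 1))) :
    |v p - interp v (node lx N i) (node lx N (i + 1)) (node ly N j) (node ly N (j + 1)) p|
      ≤ 2 * B := by
  have hp' : p ∈ cell lx ly N i j := ⟨Ico_subset_Icc_self hp.1, Ico_subset_Icc_self hp.2⟩
  refine (abs_sub _ _).trans ?_
  linarith [hB p hp', abs_interp_le (hx.node_lt i) (hy.node_lt j) hB hp']

include hi hj

lemma regular_value_error (hM : 0 < M) (hD : HasPartials (fun i j => i + j ≤ 2) v D)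
    (hB : ∀ i j, i + j ≤ 2 → ∀ p ∈ OmegaBar, |D i j p| ≤ M) {p : ℝ × ℝ}
    (hp : p ∈ Ico (node lx N i) (node lx N (i + 1)) ×ˢ Ico (node ly N j) (node ly N (j + 1))) :
    |v p - interp v (node lx N i) (node lx N (i + 1)) (node ly N j) (node ly N (j + 1)) p|
      ≤ 16 * M * (1 / N ^ 2) := by
  have hN := hx.natCast_pos
  refine (abs_sub_interp_le hD (hx.node_lt i) (hy.node_lt j) (hx.Icc_node_subset hi)
    (hy.Icc_node_subset hj) (fun q hq => regular_partial_error hx hy hM hi hj hD hB hq)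
    (fun q hq => regular_partial_error hy hx hM hj hi hD.swap_le_two
      (fun a b hab r hr => hB b a (by omega) r.swap (swap_mem_OmegaBar hr)) (p := q.swap)
      ⟨hq.2, hq.1⟩) hp).trans ?_
  have h0 : 0 ≤ 4 * M * (1 / (N : ℝ)) := by positivity
  refine (add_le_add (mul_le_mul_of_nonneg_right (hx.step_le i) h0)
    (mul_le_mul_of_nonneg_right (hy.step_le j) h0)).trans (le_of_eq ?_)
  ring

lemma first_order_value_error (hD : HasPartials (fun i j => i + j ≤ 2) v D) {Bx By : ℝ}
    (hBx : ∀ q ∈ cell lx ly N i j, |D 1 0 q| ≤ Bx)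
    (hBy : ∀ q ∈ cell lx ly N i j, |D 0 1 q| ≤ By) {p : ℝ × ℝ}
    (hp : p ∈ Ico (node lx N i) (node lx N (i + 1)) ×ˢ Ico (node ly N j) (node ly N (j + 1))) :
    |v p - interp v (node lx N i) (node lx N (i + 1)) (node ly N j) (node ly N (j + 1)) p|
      ≤ (node lx N (i + 1) - node lx N i) * (2 * Bx) +
        (node ly N (j + 1) - node ly N j) * (2 * By) := by
  refine abs_sub_interp_le hD (hx.node_lt i) (hy.node_lt j) (hx.Icc_node_subset hi)
    (hy.Icc_node_subset hj) (fun q hq => ?_) (fun q hq => ?_) hp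
  · refine (abs_sub _ _).trans ?_
    linarith [hBx q ⟨hq.1, Ico_subset_Icc_self hq.2⟩, abs_interpX_le_of_partial hD (hx.node_lt i)
      (hx.Icc_node_subset hi) (hy.Icc_node_subset hj) hBx hq.2]
  · refine (abs_sub _ _).trans ?_
    linarith [hBy q ⟨Ico_subset_Icc_self hq.1, hq.2⟩,
      abs_interpX_le_of_partial hD.swap_le_two (hy.node_lt j)
        (hy.Icc_node_subset hj) (hx.Icc_node_subset hi) (B := By)
        (fun r hr => hBy r.swap ⟨hr.2, hr.1⟩) hq.1]

lemma layer₁_value_error (hM : 0 < M) (hD : HasPartials (fun i j => i + j ≤ 2) v D)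
    (hB : ∀ i j, i + j ≤ 2 → ∀ p ∈ OmegaBar, |D i j p| ≤ M * (ε ^ i)⁻¹ * layer ε β₁ p.1)
    {p : ℝ × ℝ}
    (hp : p ∈ Ico (node lx N i) (node lx N (i + 1)) ×ˢ Ico (node ly N j) (node ly N (j + 1))) :
    |v p - interp v (node lx N i) (node lx N (i + 1)) (node ly N j) (node ly N (j + 1)) p|
      ≤ errConst β₁ β₂ M * (if 2 * i < N then 1 / (N : ℝ) ^ 2 else rate N) := by
  have hsub := cell_subset_OmegaBar hx hy hi hj
  have hε := hx.eps_pos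
  have hr := hx.rate_nonneg
  have hN := hx.natCast_pos
  have hβ₁ := hx.beta_pos
  have hβ₂ := hy.beta_pos
  have a1 : 0 < 10 / β₁ := by positivity
  have a2 : 0 < 10 / β₂ := by positivity
  split_ifs with hc
  · refine (small_value_error hx hy (B := M * (1 / (N : ℝ) ^ 2)) (fun q hq => ?_) hp).trans ?_
    · rw [← hD.zero q (hsub hq)]
      refine (hB 0 0 (by norm_num) q (hsub hq)).trans ?_
      rw [pow_zero, inv_one, mul_one]
      gcongr
      exact hx.layer_le_of_coarse hc hq.1.2
    · calc _ = M * 2 * (1 / (N : ℝ) ^ 2) := by ring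
        _ ≤ _ := by gcongr; exact mul_le_errConst hM (by norm_num) (by linarith)
  · refine (first_order_value_error hx hy hi hj hD (Bx := M * ε⁻¹) (By := M)
      (fun q hq => (hB 1 0 (by norm_num) q (hsub hq)).trans ?_)
      (fun q hq => (hB 0 1 (by norm_num) q (hsub hq)).trans ?_) hp).trans ?_
    · rw [pow_one]
      exact mul_le_of_le_one_right (by positivity) (hx.layer_le_one (hsub hq).1.2)
    · rw [pow_zero, inv_one, mul_one]
      exact mul_le_of_le_one_right (by positivity) (hx.layer_le_one (hsub hq).1.2)
    · have h1 := hy.step_le_rate j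
      rw [hx.step_fine (by omega)]
      calc _ ≤ 5 / β₁ * ε * rate N * (2 * (M * ε⁻¹)) + 4 * rate N * (2 * M) := by gcongr
        _ = M * (10 / β₁ + 8) * rate N := by field_simp; ring
        _ ≤ _ := by gcongr; exact mul_le_errConst hM (by positivity) (by linarith)

lemma layer₁₂_value_error (hM : 0 < M) (hD : HasPartials (fun i j => i + j ≤ 2) v D)
    (hB : ∀ i j, i + j ≤ 2 → ∀ p ∈ OmegaBar,
      |D i j p| ≤ M * (ε ^ (i + j))⁻¹ * (layer ε β₁ p.1 * layer ε β₂ p.2)) {p : ℝ × ℝ}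
    (hp : p ∈ Ico (node lx N i) (node lx N (i + 1)) ×ˢ Ico (node ly N j) (node ly N (j + 1))) :
    |v p - interp v (node lx N i) (node lx N (i + 1)) (node ly N j) (node ly N (j + 1)) p|
      ≤ errConst β₁ β₂ M * (if 2 * i < N ∨ 2 * j < N then 1 / (N : ℝ) ^ 2 else rate N) := by
  have hsub := cell_subset_OmegaBar hx hy hi hj
  have hε := hx.eps_pos
  have hr := hx.rate_nonneg
  have hN := hx.natCast_pos
  have hβ₁ := hx.beta_pos
  have hβ₂ := hy.beta_pos
  have a1 : 0 < 10 / β₁ := by positivity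
  have a2 : 0 < 10 / β₂ := by positivity
  have hprod : ∀ {a b : ℝ}, a ≤ 1 → 0 ≤ a → b ≤ 1 → 0 ≤ b → a * b ≤ a ∧ a * b ≤ b ∧ a * b ≤ 1 :=
    fun ha ha0 hb hb0 => ⟨mul_le_of_le_one_right ha0 hb, mul_le_of_le_one_left hb0 ha,
      mul_le_one₀ ha hb0 hb⟩
  have hP : ∀ q ∈ cell lx ly N i j, _ := fun q hq => hprod (hx.layer_le_one (hsub hq).1.2)
    (layer_pos ε β₁ q.1).le (hy.layer_le_one (hsub hq).2.2) (layer_pos ε β₂ q.2).le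
  split_ifs with hc
  · refine (small_value_error hx hy (B := M * (1 / (N : ℝ) ^ 2)) (fun q hq => ?_) hp).trans ?_
    · rw [← hD.zero q (hsub hq)]
      refine (hB 0 0 (by norm_num) q (hsub hq)).trans ?_
      rw [pow_zero, inv_one, mul_one]
      gcongr
      rcases hc with hc | hc
      · exact (hP q hq).1.trans (hx.layer_le_of_coarse hc hq.1.2)
      · exact (hP q hq).2.1.trans (hy.layer_le_of_coarse hc hq.2.2)
    · calc _ = M * 2 * (1 / (N : ℝ) ^ 2) := by ring
        _ ≤ _ := by gcongr; exact mul_le_errConst hM (by norm_num) (by linarith)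
  · push Not at hc
    refine (first_order_value_error hx hy hi hj hD (Bx := M * ε⁻¹) (By := M * ε⁻¹)
      (fun q hq => (hB 1 0 (by norm_num) q (hsub hq)).trans ?_)
      (fun q hq => (hB 0 1 (by norm_num) q (hsub hq)).trans ?_) hp).trans ?_
    · rw [show 1 + 0 = 1 from rfl, pow_one]
      exact mul_le_of_le_one_right (by positivity) (hP q hq).2.2
    · rw [show 0 + 1 = 1 from rfl, pow_one]
      exact mul_le_of_le_one_right (by positivity) (hP q hq).2.2
    · rw [hx.step_fine hc.1, hy.step_fine hc.2]
      calc _ = M * (10 / β₁ + 10 / β₂) * rate N := by field_simp; ring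
        _ ≤ _ := by gcongr; exact mul_le_errConst hM (by positivity) (by linarith)

end CellValue

/-! ### The interpolation error of the solution -/

/-- A decomposition of `u` into a regular part, two boundary layers and a corner layer, with the
partial derivatives up to order two of the components (`DS`, `D₁`, `D₂`, `D₁₂`) as explicit data. -/
structure IsLayerSum (ε β₁ β₂ M : ℝ) (u S E₁ E₂ E₁₂ : ℝ × ℝ → ℝ)
    (DS D₁ D₂ D₁₂ : ℕ → ℕ → ℝ × ℝ → ℝ) : Prop where
  sum_eq : ∀ p ∈ OmegaBar, u p = S p + E₁ p + E₂ p + E₁₂ p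
  regular : HasPartials (fun i j => i + j ≤ 2) S DS
  layer₁ : HasPartials (fun i j => i + j ≤ 2) E₁ D₁
  layer₂ : HasPartials (fun i j => i + j ≤ 2) E₂ D₂
  layer₁₂ : HasPartials (fun i j => i + j ≤ 2) E₁₂ D₁₂
  regular_le : ∀ i j, i + j ≤ 2 → ∀ p ∈ OmegaBar, |DS i j p| ≤ M
  layer₁_le : ∀ i j, i + j ≤ 2 → ∀ p ∈ OmegaBar, |D₁ i j p| ≤ M * (ε ^ i)⁻¹ * layer ε β₁ p.1
  layer₂_le : ∀ i j, i + j ≤ 2 → ∀ p ∈ OmegaBar, |D₂ i j p| ≤ M * (ε ^ j)⁻¹ * layer ε β₂ p.2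
  layer₁₂_le : ∀ i j, i + j ≤ 2 → ∀ p ∈ OmegaBar,
    |D₁₂ i j p| ≤ M * (ε ^ (i + j))⁻¹ * (layer ε β₁ p.1 * layer ε β₂ p.2)

lemma IsDecomposition.exists_isLayerSum {ε β₁ β₂ M : ℝ} {u S E₁ E₂ E₁₂ : ℝ × ℝ → ℝ}
    (h : IsDecomposition ε β₁ β₂ M u S E₁ E₂ E₁₂) :
    ∃ DS D₁ D₂ D₁₂, IsLayerSum ε β₁ β₂ M u S E₁ E₂ E₁₂ DS D₁ D₂ D₁₂ := by
  obtain ⟨DS, hS, bS⟩ := h.regular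
  obtain ⟨D₁, h₁, b₁⟩ := h.layer₁
  obtain ⟨D₂, h₂, b₂⟩ := h.layer₂
  obtain ⟨D₁₂, h₁₂, b₁₂⟩ := h.layer₁₂
  refine ⟨DS, D₁, D₂, D₁₂, h.sum_eq, hS.mono fun i j _ => by omega,
    h₁.mono fun i j _ => ⟨by omega, by omega⟩, h₂.mono fun i j _ => ⟨by omega, by omega⟩,
    h₁₂.mono fun i j _ => ⟨by omega, by omega⟩,
    fun i j _ p hp => bS i j (by omega) p hp,
    fun i j _ p hp => b₁ i j ⟨by omega, by omega⟩ p hp,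
    fun i j _ p hp => b₂ i j ⟨by omega, by omega⟩ p hp,
    fun i j _ p hp => (b₁₂ i j ⟨by omega, by omega⟩ p hp).trans (le_of_eq ?_)⟩
  rw [layer, layer, ← Real.exp_add, ← add_div, ← neg_add]

namespace IsLayerSum

variable {ε β₁ β₂ M : ℝ} {u S E₁ E₂ E₁₂ : ℝ × ℝ → ℝ} {DS D₁ D₂ D₁₂ : ℕ → ℕ → ℝ × ℝ → ℝ}
  (h : IsLayerSum ε β₁ β₂ M u S E₁ E₂ E₁₂ DS D₁ D₂ D₁₂)
include h

/-- Exchanging the coordinates exchanges the two boundary layers. -/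
lemma swap : IsLayerSum ε β₂ β₁ M (u ∘ Prod.swap) (S ∘ Prod.swap) (E₂ ∘ Prod.swap)
    (E₁ ∘ Prod.swap) (E₁₂ ∘ Prod.swap) (fun i j => DS j i ∘ Prod.swap)
    (fun i j => D₂ j i ∘ Prod.swap) (fun i j => D₁ j i ∘ Prod.swap)
    (fun i j => D₁₂ j i ∘ Prod.swap) where
  sum_eq p hp := by
    simp only [Function.comp, h.sum_eq _ (swap_mem_OmegaBar hp)]; ring
  regular := h.regular.swap_le_two
  layer₁ := h.layer₂.swap_le_two
  layer₂ := h.layer₁.swap_le_two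
  layer₁₂ := h.layer₁₂.swap_le_two
  regular_le i j hij p hp := h.regular_le j i (by omega) _ (swap_mem_OmegaBar hp)
  layer₁_le i j hij p hp := h.layer₂_le j i (by omega) _ (swap_mem_OmegaBar hp)
  layer₂_le i j hij p hp := h.layer₁_le j i (by omega) _ (swap_mem_OmegaBar hp)
  layer₁₂_le i j hij p hp := by
    have := h.layer₁₂_le j i (by omega) _ (swap_mem_OmegaBar hp)
    rw [add_comm i j, mul_comm (layer ε β₂ p.1)]
    exact this

/-- The partial derivatives of `u` are the sums of those of the components. -/
lemma hasPartials : HasPartials (fun i j => i + j ≤ 2) u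
    (fun i j p => DS i j p + D₁ i j p + D₂ i j p + D₁₂ i j p) where
  zero p hp := by
    rw [h.regular.zero p hp, h.layer₁.zero p hp, h.layer₂.zero p hp, h.layer₁₂.zero p hp,
      h.sum_eq p hp]
  dx i j hij p hp := (((h.regular.dx i j hij p hp).add (h.layer₁.dx i j hij p hp)).add
    (h.layer₂.dx i j hij p hp)).add (h.layer₁₂.dx i j hij p hp)
  dy i j hij p hp := (((h.regular.dy i j hij p hp).add (h.layer₁.dy i j hij p hp)).add
    (h.layer₂.dy i j hij p hp)).add (h.layer₁₂.dy i j hij p hp)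

lemma interpX_eq {x₀ x₁ y₀ y₁ y : ℝ} (hx₀ : x₀ ∈ Icc (0 : ℝ) 1) (hx₁ : x₁ ∈ Icc (0 : ℝ) 1)
    (hy₀ : y₀ ∈ Icc (0 : ℝ) 1) (hy₁ : y₁ ∈ Icc (0 : ℝ) 1) :
    interpX u x₀ x₁ y₀ y₁ y = interpX S x₀ x₁ y₀ y₁ y + interpX E₁ x₀ x₁ y₀ y₁ y +
      interpX E₂ x₀ x₁ y₀ y₁ y + interpX E₁₂ x₀ x₁ y₀ y₁ y := by
  simp only [interpX, h.sum_eq _ (show (x₀, y₀) ∈ OmegaBar from ⟨hx₀, hy₀⟩),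
    h.sum_eq _ (show (x₀, y₁) ∈ OmegaBar from ⟨hx₀, hy₁⟩),
    h.sum_eq _ (show (x₁, y₀) ∈ OmegaBar from ⟨hx₁, hy₀⟩),
    h.sum_eq _ (show (x₁, y₁) ∈ OmegaBar from ⟨hx₁, hy₁⟩)]
  ring

lemma interp_eq {x₀ x₁ y₀ y₁ : ℝ} (hx₀ : x₀ ∈ Icc (0 : ℝ) 1) (hx₁ : x₁ ∈ Icc (0 : ℝ) 1)
    (hy₀ : y₀ ∈ Icc (0 : ℝ) 1) (hy₁ : y₁ ∈ Icc (0 : ℝ) 1) (p : ℝ × ℝ) :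
    interp u x₀ x₁ y₀ y₁ p = interp S x₀ x₁ y₀ y₁ p + interp E₁ x₀ x₁ y₀ y₁ p +
      interp E₂ x₀ x₁ y₀ y₁ p + interp E₁₂ x₀ x₁ y₀ y₁ p := by
  simp only [interp, h.sum_eq _ (show (x₀, y₀) ∈ OmegaBar from ⟨hx₀, hy₀⟩),
    h.sum_eq _ (show (x₀, y₁) ∈ OmegaBar from ⟨hx₀, hy₁⟩),
    h.sum_eq _ (show (x₁, y₀) ∈ OmegaBar from ⟨hx₁, hy₀⟩),
    h.sum_eq _ (show (x₁, y₁) ∈ OmegaBar from ⟨hx₁, hy₁⟩)]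
  ring

variable {lx ly : ℝ} {N : ℕ} (hx : IsMesh ε β₁ lx N) (hy : IsMesh ε β₂ ly N) (hM : 0 < M)
  {i j : ℕ} (hi : i < N) (hj : j < N) {p : ℝ × ℝ}
  (hp : p ∈ Ico (node lx N i) (node lx N (i + 1)) ×ˢ Ico (node ly N j) (node ly N (j + 1)))
include hx hy hM hi hj hp

/-- The error in the `x`-derivative, with the contribution `B` of the layer along `y = 1` left
open. -/
lemma partial_error_aux {B : ℝ}
    (hB : |D₂ 1 0 p - interpX E₂ (node lx N i) (node lx N (i + 1)) (node ly N j)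
      (node ly N (j + 1)) p.2| ≤ B) :
    |DS 1 0 p + D₁ 1 0 p + D₂ 1 0 p + D₁₂ 1 0 p -
      interpX u (node lx N i) (node lx N (i + 1)) (node ly N j) (node ly N (j + 1)) p.2| ≤
      errConst β₁ β₂ M * (1 / N + 2 * (if 2 * i < N then 1 / N + ε⁻¹ * layer ε β₁ p.1
        else rate N * (ε⁻¹ * layer ε β₁ p.1))) + B := by
  have hε := hx.eps_pos
  have hN := hx.natCast_pos
  have hβ₁ := hx.beta_pos
  have hβ₂ := hy.beta_pos
  have hp' : p ∈ Icc (node lx N i) (node lx N (i + 1)) ×ˢ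
    Ico (node ly N j) (node ly N (j + 1)) := ⟨Ico_subset_Icc_self hp.1, hp.2⟩
  have eS : |DS 1 0 p - interpX S (node lx N i) (node lx N (i + 1)) (node ly N j)
      (node ly N (j + 1)) p.2| ≤ errConst β₁ β₂ M * (1 / N) := by
    refine (regular_partial_error hx hy hM hi hj h.regular h.regular_le hp').trans ?_
    gcongr
    rw [mul_comm]
    exact mul_le_errConst hM (by norm_num) (by
      have : 0 < 10 / β₁ := by positivity
      have : 0 < 10 / β₂ := by positivity
      linarith)
  have e₁ : |D₁ 1 0 p - interpX E₁ (node lx N i) (node lx N (i + 1)) (node ly N j)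
      (node ly N (j + 1)) p.2| ≤ errConst β₁ β₂ M * (if 2 * i < N then
        1 / N + ε⁻¹ * layer ε β₁ p.1 else rate N * (ε⁻¹ * layer ε β₁ p.1)) := by
    split_ifs with hc
    · refine layer_partial_error_coarse hx hy hM hi hj h.layer₁ hc (fun q hq => ?_)
        (fun q hq => ?_) hp'
      · have := h.layer₁_le 0 0 (by norm_num) q hq
        rwa [h.layer₁.zero q hq, pow_zero, inv_one, mul_one] at this
      · simpa using h.layer₁_le 1 0 (by norm_num) q hq
    · exact layer₁_partial_error_fine hx hy hM hi hj h.layer₁ (by omega) h.layer₁_le hp'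
  have e₁₂ : |D₁₂ 1 0 p - interpX E₁₂ (node lx N i) (node lx N (i + 1)) (node ly N j)
      (node ly N (j + 1)) p.2| ≤ errConst β₁ β₂ M * (if 2 * i < N then
        1 / N + ε⁻¹ * layer ε β₁ p.1 else rate N * (ε⁻¹ * layer ε β₁ p.1)) := by
    have hle : ∀ q ∈ OmegaBar, layer ε β₁ q.1 * layer ε β₂ q.2 ≤ layer ε β₁ q.1 := fun q hq =>
      mul_le_of_le_one_right (layer_pos _ _ _).le (hy.layer_le_one hq.2.2)
    split_ifs with hc
    · refine layer_partial_error_coarse hx hy hM hi hj h.layer₁₂ hc (fun q hq => ?_)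
        (fun q hq => ?_) hp'
      · have := h.layer₁₂_le 0 0 (by norm_num) q hq
        rw [h.layer₁₂.zero q hq, add_zero, pow_zero, inv_one, mul_one] at this
        exact this.trans (mul_le_mul_of_nonneg_left (hle q hq) hM.le)
      · have := h.layer₁₂_le 1 0 (by norm_num) q hq
        rw [add_zero, pow_one] at this
        exact this.trans (mul_le_mul_of_nonneg_left (hle q hq) (by positivity))
    · exact layer₁₂_partial_error_fine hx hy hM hi hj h.layer₁₂ (by omega) h.layer₁₂_le hp'
  rw [h.interpX_eq (node_mem_Icc hx.pos hx.even hx.width_pos hx.lt_one hi.le)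
    (node_mem_Icc hx.pos hx.even hx.width_pos hx.lt_one hi)
    (node_mem_Icc hy.pos hy.even hy.width_pos hy.lt_one hj.le)
    (node_mem_Icc hy.pos hy.even hy.width_pos hy.lt_one hj)]
  rw [abs_le] at eS e₁ hB e₁₂ ⊢
  constructor <;> linarith [eS.1, eS.2, e₁.1, e₁.2, hB.1, hB.2, e₁₂.1, e₁₂.2]

lemma partial_error_coarse (hci : 2 * i < N) (hcj : 2 * j < N) :
    |DS 1 0 p + D₁ 1 0 p + D₂ 1 0 p + D₁₂ 1 0 p -
      interpX u (node lx N i) (node lx N (i + 1)) (node ly N j) (node ly N (j + 1)) p.2| ≤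
      4 * errConst β₁ β₂ M * (1 / N + ε⁻¹ * layer ε β₁ p.1) := by
  have hε := hx.eps_pos
  have hN := hx.natCast_pos
  have hβ₁ := hx.beta_pos
  have hβ₂ := hy.beta_pos
  have := h.partial_error_aux hx hy hM hi hj hp (layer₂_partial_error_coarse hx hy hM hi hj
    h.layer₂ hcj h.layer₂_le ⟨Ico_subset_Icc_self hp.1, hp.2⟩)
  rw [if_pos hci] at this
  have k : M * 2 ≤ errConst β₁ β₂ M := mul_le_errConst hM (by norm_num) (by
      have : 0 < 10 / β₁ := by positivity
      have : 0 < 10 / β₂ := by positivity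
      linarith)
  have k0 : 0 ≤ errConst β₁ β₂ M := by linarith
  have k1 := mul_le_mul_of_nonneg_right k (show 0 ≤ 1 / (N : ℝ) by positivity)
  have k2 : 0 ≤ errConst β₁ β₂ M * (ε⁻¹ * layer ε β₁ p.1) :=
    mul_nonneg k0 (mul_nonneg (by positivity) (layer_pos _ _ _).le)
  linarith

lemma partial_error :
    |DS 1 0 p + D₁ 1 0 p + D₂ 1 0 p + D₁₂ 1 0 p -
      interpX u (node lx N i) (node lx N (i + 1)) (node ly N j) (node ly N (j + 1)) p.2| ≤
      10 * errConst β₁ β₂ M *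
        (rate N + (if 2 * i < N then 1 else rate N) * (ε⁻¹ * layer ε β₁ p.1)) := by
  have hε := hx.eps_pos
  have hN := hx.natCast_pos
  have hβ₁ := hx.beta_pos
  have hβ₂ := hy.beta_pos
  have hr := hx.rate_nonneg
  have hl := layer_pos ε β₁ p.1
  have k : M * 2 ≤ errConst β₁ β₂ M := mul_le_errConst hM (by norm_num) (by
      have : 0 < 10 / β₁ := by positivity
      have : 0 < 10 / β₂ := by positivity
      linarith)
  have k0 : 0 ≤ errConst β₁ β₂ M := by linarith
  have hp' : p ∈ Icc (node lx N i) (node lx N (i + 1)) ×ˢ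
    Ico (node ly N j) (node ly N (j + 1)) := ⟨Ico_subset_Icc_self hp.1, hp.2⟩
  have hB : |D₂ 1 0 p - interpX E₂ (node lx N i) (node lx N (i + 1)) (node ly N j)
      (node ly N (j + 1)) p.2| ≤ errConst β₁ β₂ M * (2 * rate N) := by
    rcases lt_or_ge (2 * j) N with hc | hc
    · refine (layer₂_partial_error_coarse hx hy hM hi hj h.layer₂ hc h.layer₂_le hp').trans ?_
      rw [mul_comm 2 M]
      gcongr
      exact hx.inv_le_rate
    · refine (layer₂_partial_error_fine hx hy hM hi hj h.layer₂ hc h.layer₂_le hp').trans ?_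
      gcongr; linarith
  refine (h.partial_error_aux hx hy hM hi hj hp hB).trans ?_
  have h1 := hx.inv_le_rate
  have hg : 0 ≤ ε⁻¹ * layer ε β₁ p.1 := by positivity
  have hrg : 0 ≤ rate N * (ε⁻¹ * layer ε β₁ p.1) := by positivity
  rw [← mul_add, mul_comm 10, mul_assoc]
  apply mul_le_mul_of_nonneg_left _ k0
  split_ifs <;> linarith

lemma value_error_aux :
    |u p - interp u (node lx N i) (node lx N (i + 1)) (node ly N j) (node ly N (j + 1)) p| ≤
      errConst β₁ β₂ M * (1 / (N : ℝ) ^ 2 + (if 2 * i < N then 1 / (N : ℝ) ^ 2 else rate N) +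
        (if 2 * j < N then 1 / (N : ℝ) ^ 2 else rate N) +
        (if 2 * i < N ∨ 2 * j < N then 1 / (N : ℝ) ^ 2 else rate N)) := by
  have hN := hx.natCast_pos
  have hβ₁ := hx.beta_pos
  have hβ₂ := hy.beta_pos
  have hpO : p ∈ OmegaBar := cell_subset_OmegaBar hx hy hi hj
    ⟨Ico_subset_Icc_self hp.1, Ico_subset_Icc_self hp.2⟩
  have eS : |S p - interp S (node lx N i) (node lx N (i + 1)) (node ly N j)
      (node ly N (j + 1)) p| ≤ errConst β₁ β₂ M * (1 / (N : ℝ) ^ 2) := by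
    refine (regular_value_error hx hy hi hj hM h.regular h.regular_le hp).trans ?_
    gcongr
    rw [mul_comm]
    exact mul_le_errConst hM (by norm_num) (by
      have : 0 < 10 / β₁ := by positivity
      have : 0 < 10 / β₂ := by positivity
      linarith)
  have e₁ := layer₁_value_error hx hy hi hj hM h.layer₁ h.layer₁_le hp
  have e₂ := layer₁_value_error hy hx hj hi hM h.swap.layer₁ h.swap.layer₁_le (p := p.swap)
    ⟨hp.2, hp.1⟩
  rw [interp_swap, errConst_comm, Function.comp, Prod.swap_swap] at e₂
  have e₁₂ := layer₁₂_value_error hx hy hi hj hM h.layer₁₂ h.layer₁₂_le hp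
  rw [h.interp_eq (node_mem_Icc hx.pos hx.even hx.width_pos hx.lt_one hi.le)
    (node_mem_Icc hx.pos hx.even hx.width_pos hx.lt_one hi)
    (node_mem_Icc hy.pos hy.even hy.width_pos hy.lt_one hj.le)
    (node_mem_Icc hy.pos hy.even hy.width_pos hy.lt_one hj), h.sum_eq p hpO]
  rw [abs_le] at eS e₁ e₂ e₁₂ ⊢
  constructor <;> linarith [eS.1, eS.2, e₁.1, e₁.2, e₂.1, e₂.2, e₁₂.1, e₁₂.2]

end IsLayerSum

/-! ### The weak gradient of a piecewise smooth function -/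

lemma measurableSet_Omega : MeasurableSet Omega := measurableSet_Ioo.prod measurableSet_Ioo

lemma isCompact_OmegaBar : IsCompact OmegaBar := isCompact_Icc.prod isCompact_Icc

lemma Omega_subset_OmegaBar : Omega ⊆ OmegaBar := prod_mono Ioo_subset_Icc_self Ioo_subset_Icc_self

lemma volume_Omega : volume Omega = 1 := by
  rw [Omega, Measure.volume_eq_prod, Measure.prod_prod]; simp

lemma IsWeakGradient.mono {U V : Set (ℝ × ℝ)} {w : ℝ × ℝ → ℝ} {g : ℝ × ℝ → ℝ × ℝ}
    (h : IsWeakGradient U w g) (hU : MeasurableSet U) (hVU : V ⊆ U) : IsWeakGradient V w g := by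
  have key : ∀ (F ψ : ℝ × ℝ → ℝ), (∀ p, p ∉ V → ψ p = 0) →
      ∫ p in U, F p * ψ p = ∫ p in V, F p * ψ p := fun F ψ hψ =>
    setIntegral_eq_of_subset_of_forall_sdiff_eq_zero hU hVU fun p hp => by rw [hψ p hp.2, mul_zero]
  have hφ0 : ∀ {φ : ℝ × ℝ → ℝ}, tsupport φ ⊆ V → ∀ p, p ∉ V → φ p = 0 := fun hφ p hp =>
    image_eq_zero_of_notMem_tsupport fun hp' => hp (hφ hp')
  have hφ1 : ∀ {φ : ℝ × ℝ → ℝ}, tsupport φ ⊆ V → ∀ p, p ∉ V → fderiv ℝ φ p = 0 := fun hφ p hp =>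
    image_eq_zero_of_notMem_tsupport fun hp' => hp (hφ (tsupport_fderiv_subset ℝ hp'))
  refine ⟨h.locallyIntegrable.mono_set hVU, h.locallyIntegrable_fst.mono_set hVU,
    h.locallyIntegrable_snd.mono_set hVU, fun φ h1 h2 h3 => ?_, fun φ h1 h2 h3 => ?_⟩
  · rw [← key _ _ (hφ0 h3), ← key _ _ fun p hp => by rw [hφ1 h3 p hp]; rfl]
    exact h.integral_dx φ h1 h2 (h3.trans hVU)
  · rw [← key _ _ (hφ0 h3), ← key _ _ fun p hp => by rw [hφ1 h3 p hp]; rfl]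
    exact h.integral_dy φ h1 h2 (h3.trans hVU)

/-- Integration by parts on horizontal lines: a continuous function whose `x`-derivative is `g`
off finitely or countably many vertical lines has weak `x`-derivative `g`. -/
lemma integral_mul_fderiv_fst {w g φ : ℝ × ℝ → ℝ} {s : Set ℝ} (hw : ContinuousOn w OmegaBar)
    (hg : IntegrableOn g Omega) (hs : s.Countable)
    (hd : ∀ y ∈ Ioo (0 : ℝ) 1, ∀ x ∈ Ioo (0 : ℝ) 1 \ s,
      HasDerivAt (fun t => w (t, y)) (g (x, y)) x)
    (hφ : ContDiff ℝ ∞ φ) (hφc : HasCompactSupport φ) (hφs : tsupport φ ⊆ Omega) :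
    ∫ p in Omega, w p * fderiv ℝ φ p (1, 0) = -∫ p in Omega, g p * φ p := by
  have hφd : Continuous fun p => fderiv ℝ φ p (1, 0) :=
    (hφ.continuous_fderiv (by norm_num)).clm_apply continuous_const
  have i1 : IntegrableOn (fun p => w p * fderiv ℝ φ p (1, 0)) Omega :=
    ((hw.mul hφd.continuousOn).integrableOn_compact isCompact_OmegaBar).mono_set
      Omega_subset_OmegaBar
  obtain ⟨B, hB⟩ := hφc.exists_bound_of_continuous hφ.continuous
  have i2 : IntegrableOn (fun p => g p * φ p) Omega :=
    hg.mul_bdd hφ.continuous.aestronglyMeasurable (Filter.Eventually.of_forall hB)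
  have hφ0 : ∀ p, p ∉ Omega → φ p = 0 := fun p hp =>
    image_eq_zero_of_notMem_tsupport fun hp' => hp (hφs hp')
  rw [eq_neg_iff_add_eq_zero, ← integral_add i1 i2]
  have i3 : IntegrableOn (fun p => w p * fderiv ℝ φ p (1, 0) + g p * φ p) Omega := i1.add i2
  rw [IntegrableOn, Omega, Measure.volume_eq_prod, ← Measure.prod_restrict] at i3
  rw [Omega, Measure.volume_eq_prod, ← Measure.prod_restrict, integral_prod_symm _ i3]
  refine integral_eq_zero_of_ae ?_
  filter_upwards [i3.prod_left_ae, ae_restrict_mem measurableSet_Ioo] with y hy hyI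
  have hyc : y ∈ Icc (0 : ℝ) 1 := Ioo_subset_Icc_self hyI
  have ftc := integral_eq_of_hasDerivAt_off_countable (fun x => w (x, y) * φ (x, y))
    (fun x => w (x, y) * fderiv ℝ φ (x, y) (1, 0) + g (x, y) * φ (x, y)) (a := 0) (b := 1) hs
    ?_ ?_ ?_
  · rw [intervalIntegral.integral_of_le zero_le_one, integral_Ioc_eq_integral_Ioo] at ftc
    simp only [Pi.zero_apply]
    rw [ftc, hφ0 (1, y) fun h => lt_irrefl _ h.1.2, hφ0 (0, y) fun h => lt_irrefl _ h.1.1]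
    simp
  · rw [uIcc_of_le zero_le_one]
    refine ContinuousOn.mul ?_ ?_
    · exact hw.comp (by fun_prop) fun x hx => ⟨hx, hyc⟩
    · exact (hφ.continuous.comp (by fun_prop)).continuousOn
  · intro x hx
    rw [min_eq_left zero_le_one, max_eq_right zero_le_one] at hx
    have hφx : HasDerivAt (fun t => φ (t, y)) (fderiv ℝ φ (x, y) (1, 0)) x :=
      (hφ.differentiable (by norm_num) (x, y)).hasFDerivAt.comp_hasDerivAt x
        ((hasDerivAt_id x).prodMk (hasDerivAt_const x y))
    exact ((hd y hyI x hx).mul hφx).congr_deriv (add_comm _ _)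
  · rw [intervalIntegrable_iff_integrableOn_Ioo_of_le zero_le_one]
    exact hy

lemma setIntegral_Omega_swap (F : ℝ × ℝ → ℝ) :
    ∫ p in Omega, F p.swap = ∫ p in Omega, F p := by
  rw [Omega, Measure.volume_eq_prod]
  exact setIntegral_prod_swap _ _ F

lemma fderiv_comp_swap {φ : ℝ × ℝ → ℝ} (hφ : Differentiable ℝ φ) (p : ℝ × ℝ) :
    fderiv ℝ (φ ∘ Prod.swap) p (1, 0) = fderiv ℝ φ p.swap (0, 1) := by
  have h : HasFDerivAt (φ ∘ Prod.swap) ((fderiv ℝ φ p.swap).comp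
      ((ContinuousLinearMap.snd ℝ ℝ ℝ).prod (ContinuousLinearMap.fst ℝ ℝ ℝ))) p :=
    (hφ p.swap).hasFDerivAt.comp p
      ((ContinuousLinearMap.snd ℝ ℝ ℝ).prod (ContinuousLinearMap.fst ℝ ℝ ℝ)).hasFDerivAt
  rw [h.fderiv]
  simp

/-- The counterpart of `integral_mul_fderiv_fst` in the other variable, stated with exchanged
coordinates. -/
lemma integral_mul_fderiv_snd {w g φ : ℝ × ℝ → ℝ} {s : Set ℝ}
    (hw : ContinuousOn (w ∘ Prod.swap) OmegaBar)
    (hg : IntegrableOn (g ∘ Prod.swap) Omega) (hs : s.Countable)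
    (hd : ∀ y ∈ Ioo (0 : ℝ) 1, ∀ x ∈ Ioo (0 : ℝ) 1 \ s,
      HasDerivAt (fun t => w (y, t)) (g (y, x)) x)
    (hφ : ContDiff ℝ ∞ φ) (hφc : HasCompactSupport φ) (hφs : tsupport φ ⊆ Omega) :
    ∫ p in Omega, w p * fderiv ℝ φ p (0, 1) = -∫ p in Omega, g p * φ p := by
  have hφ' : ContDiff ℝ ∞ (φ ∘ Prod.swap) := hφ.comp (contDiff_snd.prodMk contDiff_fst)
  have := integral_mul_fderiv_fst (φ := φ ∘ Prod.swap) hw hg hs hd hφ'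
    (hφc.comp_homeomorph (Homeomorph.prodComm ℝ ℝ)) (by
      have := tsupport_comp_eq_preimage φ (Homeomorph.prodComm ℝ ℝ)
      rw [Homeomorph.coe_prodComm] at this
      rw [this]
      intro p hp
      have h := hφs hp
      exact ⟨h.2, h.1⟩)
  simp only [fderiv_comp_swap (hφ.differentiable (by norm_num))] at this
  rw [← setIntegral_Omega_swap, ← setIntegral_Omega_swap (fun p => g p * φ p)]
  exact this

/-! ### The gradient of the piecewise bilinear interpolant -/

/-- The elementwise `x`-derivative of the piecewise bilinear interpolant of `u`. -/
noncomputable def gradX (u : ℝ × ℝ → ℝ) (lx ly : ℝ) (N : ℕ) (p : ℝ × ℝ) : ℝ :=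
  interpX u (node lx N (meshIndex lx N p.1)) (node lx N (meshIndex lx N p.1 + 1))
    (node ly N (meshIndex ly N p.2)) (node ly N (meshIndex ly N p.2 + 1)) p.2

lemma measurable_gradX (u : ℝ × ℝ → ℝ) (lx ly : ℝ) (N : ℕ) : Measurable (gradX u lx ly N) := by
  have key : ∀ F : ℕ × ℕ → ℝ,
      Measurable fun p : ℝ × ℝ => F (meshIndex lx N p.1, meshIndex ly N p.2) := fun F =>
    (measurable_of_countable F).comp (((measurable_meshIndex lx N).comp measurable_fst).prodMk
      ((measurable_meshIndex ly N).comp measurable_snd))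
  unfold gradX interpX
  exact ((((key fun q => node ly N (q.2 + 1)).sub measurable_snd).mul
    (key fun q => u (node lx N (q.1 + 1), node ly N q.2) - u (node lx N q.1, node ly N q.2))).add
    ((measurable_snd.sub (key fun q => node ly N q.2)).mul
    (key fun q => u (node lx N (q.1 + 1), node ly N (q.2 + 1)) -
      u (node lx N q.1, node ly N (q.2 + 1))))).div
    (key fun q => (node lx N (q.1 + 1) - node lx N q.1) * (node ly N (q.2 + 1) - node ly N q.2))

lemma IsBilinearInterpolant.swap {lx ly : ℝ} {N : ℕ} {u v : ℝ × ℝ → ℝ}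
    (h : IsBilinearInterpolant lx ly N u v) :
    IsBilinearInterpolant ly lx N (u ∘ Prod.swap) (v ∘ Prod.swap) where
  bilinear i hi j hj := by
    obtain ⟨a₀, a₁, a₂, a₃, ha⟩ := h.bilinear j hj i hi
    refine ⟨a₀, a₂, a₁, a₃, fun p hp => ?_⟩
    rw [Function.comp, ha p.swap ⟨hp.2, hp.1⟩, Prod.fst_swap, Prod.snd_swap]
    ring
  interpolates i hi j hj := h.interpolates j hj i hi

/-- A function with bounded partial derivatives on the closed square is Lipschitz, hence
continuous. -/
lemma continuousOn_of_partials {f fx fy : ℝ × ℝ → ℝ} {B : ℝ}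
    (hx : ∀ p ∈ OmegaBar, HasDerivWithinAt (fun s => f (s, p.2)) (fx p) (Icc 0 1) p.1)
    (hy : ∀ p ∈ OmegaBar, HasDerivWithinAt (fun t => f (p.1, t)) (fy p) (Icc 0 1) p.2)
    (bx : ∀ p ∈ OmegaBar, |fx p| ≤ B) (bY : ∀ p ∈ OmegaBar, |fy p| ≤ B) :
    ContinuousOn f OmegaBar := by
  have hB : 0 ≤ B := (abs_nonneg _).trans
    (bx (0, 0) ⟨left_mem_Icc.2 zero_le_one, left_mem_Icc.2 zero_le_one⟩)
  refine (LipschitzOnWith.of_dist_le_mul (K := (2 * B).toNNReal) fun p hp q hq => ?_).continuousOn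
  rw [Real.coe_toNNReal _ (by positivity), Real.dist_eq]
  have e₁ := (convex_Icc (0 : ℝ) 1).norm_image_sub_le_of_norm_hasDerivWithin_le
    (f := fun s => f (s, p.2)) (fun s hs => hx (s, p.2) ⟨hs, hp.2⟩)
    (fun s hs => bx (s, p.2) ⟨hs, hp.2⟩) hq.1 hp.1
  have e₂ := (convex_Icc (0 : ℝ) 1).norm_image_sub_le_of_norm_hasDerivWithin_le
    (f := fun s => f (q.1, s)) (fun s hs => hy (q.1, s) ⟨hq.1, hs⟩)
    (fun s hs => bY (q.1, s) ⟨hq.1, hs⟩) hq.2 hp.2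
  have d₁ : ‖p.1 - q.1‖ ≤ dist p q := le_max_left _ _
  have d₂ : ‖p.2 - q.2‖ ≤ dist p q := le_max_right _ _
  have e₃ := mul_le_mul_of_nonneg_left d₁ hB
  have e₄ := mul_le_mul_of_nonneg_left d₂ hB
  calc |f p - f q| = |(f (p.1, p.2) - f (q.1, p.2)) + (f (q.1, p.2) - f (q.1, q.2))| := by
        congr 1; ring
    _ ≤ _ := abs_add_le _ _
    _ ≤ B * ‖p.1 - q.1‖ + B * ‖p.2 - q.2‖ := add_le_add e₁ e₂
    _ ≤ _ := by linarith

section Interpolant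

variable {ε β₁ β₂ lx ly : ℝ} {N : ℕ} (hx : IsMesh ε β₁ lx N) (hy : IsMesh ε β₂ ly N)
  {u uI : ℝ × ℝ → ℝ} (hI : IsBilinearInterpolant lx ly N u uI)
include hx hy hI

lemma IsBilinearInterpolant.eq_interp {i j : ℕ} (hi : i < N) (hj : j < N) {p : ℝ × ℝ}
    (hp : p ∈ cell lx ly N i j) :
    uI p = interp u (node lx N i) (node lx N (i + 1)) (node ly N j) (node ly N (j + 1)) p := by
  obtain ⟨a₀, a₁, a₂, a₃, ha⟩ := hI.bilinear i hi j hj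
  exact interp_eq_of_bilinear (hx.node_lt i) (hy.node_lt j) ha (hI.interpolates _ hi.le _ hj.le)
    (hI.interpolates _ hi.le _ hj) (hI.interpolates _ hi _ hj.le) (hI.interpolates _ hi _ hj) hp

lemma IsBilinearInterpolant.continuousOn : ContinuousOn uI OmegaBar := by
  have hc : ContinuousOn uI (⋃ k : Fin N × Fin N, cell lx ly N k.1 k.2) := by
    refine (locallyFinite_of_finite _).continuousOn_iUnion
      (fun k => isClosed_Icc.prod isClosed_Icc) fun k => ?_
    obtain ⟨a₀, a₁, a₂, a₃, ha⟩ := hI.bilinear k.1 k.1.2 k.2 k.2.2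
    have hc : Continuous fun p : ℝ × ℝ => a₀ + a₁ * p.1 + a₂ * p.2 + a₃ * (p.1 * p.2) := by
      fun_prop
    exact hc.continuousOn.congr ha
  have hcov : ∀ {l β : ℝ}, IsMesh ε β l N → ∀ x ∈ Icc (0 : ℝ) 1,
      ∃ i : Fin N, x ∈ Icc (node l N i) (node l N (i + 1)) := by
    intro l β hl x hx
    rcases hx.2.lt_or_eq with h | h
    · exact ⟨⟨_, meshIndex_lt hl.pos x⟩, Ico_subset_Icc_self (mem_Ico_meshIndex hl.pos ⟨hx.1, h⟩)⟩
    · have hN := hl.pos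
      refine ⟨⟨N - 1, by omega⟩, ?_⟩
      have e := node_last (l := l) hl.pos
      have e' := hl.node_lt (N - 1)
      have e'' : N - 1 + 1 = N := by omega
      rw [e'', e] at e'
      simp only [e'', e, h]
      exact ⟨e'.le, le_rfl⟩
  refine hc.mono fun p hp => ?_
  obtain ⟨i, hi⟩ := hcov hx p.1 hp.1
  obtain ⟨j, hj⟩ := hcov hy p.2 hp.2
  exact mem_iUnion.2 ⟨(i, j), hi, hj⟩

lemma IsBilinearInterpolant.hasDerivAt {x y : ℝ} (hxI : x ∈ Ioo (0 : ℝ) 1 \ range (node lx N))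
    (hyI : y ∈ Ioo (0 : ℝ) 1) : HasDerivAt (fun t => uI (t, y)) (gradX u lx ly N (x, y)) x := by
  have mx := mem_Ico_meshIndex (l := lx) hx.pos (Ioo_subset_Ico_self hxI.1)
  have my := mem_Ico_meshIndex (l := ly) hx.pos (Ioo_subset_Ico_self hyI)
  have mx' : x ∈ Ioo (node lx N (meshIndex lx N x)) (node lx N (meshIndex lx N x + 1)) :=
    ⟨lt_of_le_of_ne mx.1 fun h => hxI.2 ⟨_, h⟩, mx.2⟩
  refine (hasDerivAt_interp u _ _ _ _ x y).congr_of_eventuallyEq ?_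
  filter_upwards [isOpen_Ioo.mem_nhds mx'] with t ht
  exact hI.eq_interp hx hy (meshIndex_lt hx.pos x) (meshIndex_lt hx.pos y)
    ⟨Ioo_subset_Icc_self ht, Ico_subset_Icc_self my⟩

end Interpolant

/-! ### Global pointwise bounds for the interpolation error -/

/-- The size of the `x`-derivative of the error caused by the layer along `x = 1`. -/
noncomputable def slope (ε β l : ℝ) (N : ℕ) (x : ℝ) : ℝ :=
  (if x < 1 - l then 1 else rate N) * (ε⁻¹ * layer ε β x)

namespace IsLayerSum

variable {ε β₁ β₂ M : ℝ} {u S E₁ E₂ E₁₂ : ℝ × ℝ → ℝ} {DS D₁ D₂ D₁₂ : ℕ → ℕ → ℝ × ℝ → ℝ}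
  (h : IsLayerSum ε β₁ β₂ M u S E₁ E₂ E₁₂ DS D₁ D₂ D₁₂)
  {lx ly : ℝ} {N : ℕ} (hx : IsMesh ε β₁ lx N) (hy : IsMesh ε β₂ ly N) (hM : 0 < M)

include h hx hy hM

lemma abs_gradX_error_le {p : ℝ × ℝ} (hp : p ∈ Ico (0 : ℝ) 1 ×ˢ Ico (0 : ℝ) 1) :
    |DS 1 0 p + D₁ 1 0 p + D₂ 1 0 p + D₁₂ 1 0 p - gradX u lx ly N p| ≤
      10 * errConst β₁ β₂ M * (rate N + slope ε β₁ lx N p.1) := by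
  have := h.partial_error hx hy hM (meshIndex_lt hx.pos p.1) (meshIndex_lt hy.pos p.2)
    ⟨mem_Ico_meshIndex hx.pos hp.1, mem_Ico_meshIndex hy.pos hp.2⟩
  simp only [hx.meshIndex_coarse_iff hp.1] at this
  exact this

/-- On the coarse part the gradient of the layer is kept as it is, while that of its interpolant is
of order `N⁻¹`. -/
lemma abs_gradX_error_le_coarse {p : ℝ × ℝ} (hp : p ∈ Ico 0 (1 - lx) ×ˢ Ico 0 (1 - ly)) :
    |DS 1 0 p + D₁ 1 0 p + D₂ 1 0 p + D₁₂ 1 0 p - gradX u lx ly N p| ≤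
      4 * errConst β₁ β₂ M * (1 / N + ε⁻¹ * layer ε β₁ p.1) := by
  have h1 : p.1 ∈ Ico (0 : ℝ) 1 := ⟨hp.1.1, by linarith [hp.1.2, hx.width_pos]⟩
  have h2 : p.2 ∈ Ico (0 : ℝ) 1 := ⟨hp.2.1, by linarith [hp.2.2, hy.width_pos]⟩
  exact h.partial_error_coarse hx hy hM (meshIndex_lt hx.pos p.1) (meshIndex_lt hy.pos p.2)
    ⟨mem_Ico_meshIndex hx.pos h1, mem_Ico_meshIndex hy.pos h2⟩
    ((hx.meshIndex_coarse_iff h1).2 hp.1.2) ((hy.meshIndex_coarse_iff h2).2 hp.2.2)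

lemma abs_value_error_le {uI : ℝ × ℝ → ℝ} (hI : IsBilinearInterpolant lx ly N u uI)
    {p : ℝ × ℝ} (hp : p ∈ Ico (0 : ℝ) 1 ×ˢ Ico (0 : ℝ) 1) :
    |u p - uI p| ≤ 10 * errConst β₁ β₂ M * rate N := by
  have m1 := mem_Ico_meshIndex (l := lx) hx.pos hp.1
  have m2 := mem_Ico_meshIndex (l := ly) hx.pos hp.2
  have := h.value_error_aux hx hy hM (meshIndex_lt hx.pos p.1) (meshIndex_lt hy.pos p.2) ⟨m1, m2⟩
  rw [hI.eq_interp hx hy (meshIndex_lt hx.pos p.1) (meshIndex_lt hy.pos p.2)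
    ⟨Ico_subset_Icc_self m1, Ico_subset_Icc_self m2⟩]
  refine this.trans ?_
  have hK : 0 ≤ errConst β₁ β₂ M := by
    have := hx.beta_pos
    have := hy.beta_pos
    unfold errConst; positivity
  have hr := hx.rate_nonneg
  have hN := hx.inv_sq_le_inv.trans hx.inv_le_rate
  rw [mul_comm 10, mul_assoc]
  refine mul_le_mul_of_nonneg_left ?_ hK
  split_ifs <;> linarith

lemma abs_value_error_le_coarse {uI : ℝ × ℝ → ℝ} (hI : IsBilinearInterpolant lx ly N u uI)
    {p : ℝ × ℝ} (hp : p ∈ Ico 0 (1 - lx) ×ˢ Ico 0 (1 - ly)) :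
    |u p - uI p| ≤ 4 * errConst β₁ β₂ M * (1 / (N : ℝ) ^ 2) := by
  have h1 : p.1 ∈ Ico (0 : ℝ) 1 := ⟨hp.1.1, by linarith [hp.1.2, hx.width_pos]⟩
  have h2 : p.2 ∈ Ico (0 : ℝ) 1 := ⟨hp.2.1, by linarith [hp.2.2, hy.width_pos]⟩
  have m1 := mem_Ico_meshIndex (l := lx) hx.pos h1
  have m2 := mem_Ico_meshIndex (l := ly) hx.pos h2
  have c1 := (hx.meshIndex_coarse_iff h1).2 hp.1.2
  have c2 := (hy.meshIndex_coarse_iff h2).2 hp.2.2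
  have := h.value_error_aux hx hy hM (meshIndex_lt hx.pos p.1) (meshIndex_lt hy.pos p.2) ⟨m1, m2⟩
  rw [hI.eq_interp hx hy (meshIndex_lt hx.pos p.1) (meshIndex_lt hy.pos p.2)
    ⟨Ico_subset_Icc_self m1, Ico_subset_Icc_self m2⟩]
  rw [if_pos c1, if_pos c2, if_pos (Or.inl c1)] at this
  linarith

lemma abs_partials_le : ∃ B, ∀ i j, i + j ≤ 2 → ∀ p ∈ OmegaBar,
    |DS i j p + D₁ i j p + D₂ i j p + D₁₂ i j p| ≤ B := by
  have hε := hx.eps_pos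
  have hpow : ∀ k ≤ 2, (ε ^ k)⁻¹ ≤ (1 + ε⁻¹) ^ 2 := by
    intro k hk
    have h0 : 0 < ε⁻¹ := by positivity
    rw [← inv_pow]
    calc ε⁻¹ ^ k ≤ (1 + ε⁻¹) ^ k := by gcongr; linarith
      _ ≤ (1 + ε⁻¹) ^ 2 := pow_le_pow_right₀ (by linarith) hk
  refine ⟨M + 3 * (M * (1 + ε⁻¹) ^ 2), fun i j hij p hp => ?_⟩
  have l₁ := hx.layer_le_one hp.1.2
  have l₂ := hy.layer_le_one hp.2.2
  have p₁ := layer_pos ε β₁ p.1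
  have p₂ := layer_pos ε β₂ p.2
  have key : ∀ k ≤ 2, ∀ t : ℝ, 0 ≤ t → t ≤ 1 → M * (ε ^ k)⁻¹ * t ≤ M * (1 + ε⁻¹) ^ 2 := by
    intro k hk t h0 h1
    have := hpow k hk
    calc M * (ε ^ k)⁻¹ * t ≤ M * (1 + ε⁻¹) ^ 2 * 1 := by gcongr
      _ = _ := mul_one _
  have eS := h.regular_le i j hij p hp
  have e₁ := (h.layer₁_le i j hij p hp).trans (key i (by omega) _ p₁.le l₁)
  have e₂ := (h.layer₂_le i j hij p hp).trans (key j (by omega) _ p₂.le l₂)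
  have e₁₂ := (h.layer₁₂_le i j hij p hp).trans
    (key (i + j) hij _ (by positivity) (mul_le_one₀ l₁ p₂.le l₂))
  rw [abs_le] at *
  constructor <;> linarith [eS.1, eS.2, e₁.1, e₁.2, e₂.1, e₂.2, e₁₂.1, e₁₂.2]

lemma continuousOn_partial {i j : ℕ} (hij : i + j ≤ 1) :
    ContinuousOn (fun p => DS i j p + D₁ i j p + D₂ i j p + D₁₂ i j p) OmegaBar := by
  obtain ⟨B, hB⟩ := h.abs_partials_le hx hy hM
  exact continuousOn_of_partials (h.hasPartials.dx i j (by omega)) (h.hasPartials.dy i j (by omega))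
    (hB _ _ (by omega)) (hB _ _ (by omega))

lemma integrableOn_gradX_error :
    IntegrableOn (fun p => DS 1 0 p + D₁ 1 0 p + D₂ 1 0 p + D₁₂ 1 0 p - gradX u lx ly N p)
      Omega := by
  have hε := hx.eps_pos
  have hr := hx.rate_nonneg
  have hr' := hx.rate_le_one
  have hK : 0 ≤ errConst β₁ β₂ M := by
    have := hx.beta_pos
    have := hy.beta_pos
    unfold errConst; positivity
  refine IntegrableOn.of_bound (by rw [volume_Omega]; exact ENNReal.one_lt_top) ?_
    (10 * errConst β₁ β₂ M * (1 + ε⁻¹)) ?_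
  · exact (((h.continuousOn_partial hx hy hM (by norm_num)).mono
      Omega_subset_OmegaBar).aestronglyMeasurable measurableSet_Omega).sub
      (measurable_gradX u lx ly N).aestronglyMeasurable
  · filter_upwards [ae_restrict_mem measurableSet_Omega] with p hp
    refine (h.abs_gradX_error_le hx hy hM ⟨Ioo_subset_Ico_self hp.1,
      Ioo_subset_Ico_self hp.2⟩).trans ?_
    have hl := hx.layer_le_one hp.1.2.le
    have hl' := layer_pos ε β₁ p.1
    gcongr
    unfold slope
    calc _ ≤ 1 * (ε⁻¹ * 1) := by
          gcongr
          split_ifs <;> linarith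
      _ = _ := by ring

omit hM in
lemma hasDerivAt_error {uI : ℝ × ℝ → ℝ} (hI : IsBilinearInterpolant lx ly N u uI) {x y : ℝ}
    (hxI : x ∈ Ioo (0 : ℝ) 1 \ range (node lx N)) (hyI : y ∈ Ioo (0 : ℝ) 1) :
    HasDerivAt (fun t => u (t, y) - uI (t, y)) (DS 1 0 (x, y) + D₁ 1 0 (x, y) + D₂ 1 0 (x, y) +
      D₁₂ 1 0 (x, y) - gradX u lx ly N (x, y)) x := by
  refine HasDerivAt.sub ?_ (hI.hasDerivAt hx hy hxI hyI)
  have hyc := Ioo_subset_Icc_self hyI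
  refine ((h.hasPartials.dx 0 0 (by norm_num) (x, y) ⟨Ioo_subset_Icc_self hxI.1, hyc⟩).hasDerivAt
    (Icc_mem_nhds hxI.1.1 hxI.1.2)).congr_of_eventuallyEq ?_
  filter_upwards [Icc_mem_nhds hxI.1.1 hxI.1.2] with t ht
  exact (h.hasPartials.zero (t, y) ⟨ht, hyc⟩).symm

lemma continuousOn_error {uI : ℝ × ℝ → ℝ} (hI : IsBilinearInterpolant lx ly N u uI) :
    ContinuousOn (fun p => u p - uI p) OmegaBar :=
  ((h.continuousOn_partial hx hy hM (i := 0) (j := 0) (by norm_num)).congr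
    fun p hp => (h.hasPartials.zero p hp).symm).sub (hI.continuousOn hx hy)

/-- The elementwise gradient of the interpolation error is its weak gradient. -/
lemma isWeakGradient_error {uI : ℝ × ℝ → ℝ} (hI : IsBilinearInterpolant lx ly N u uI) :
    IsWeakGradient Omega (fun p => u p - uI p) (fun p =>
      (DS 1 0 p + D₁ 1 0 p + D₂ 1 0 p + D₁₂ 1 0 p - gradX u lx ly N p,
        DS 0 1 p + D₂ 0 1 p + D₁ 0 1 p + D₁₂ 0 1 p -
          gradX (u ∘ Prod.swap) ly lx N p.swap)) := by
  have hc := h.continuousOn_error hx hy hM hI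
  have hc' := h.swap.continuousOn_error hy hx hM hI.swap
  have hg := h.integrableOn_gradX_error hx hy hM
  have hg' := h.swap.integrableOn_gradX_error hy hx hM
  refine ⟨((hc.integrableOn_compact isCompact_OmegaBar).mono_set
    Omega_subset_OmegaBar).locallyIntegrableOn, hg.locallyIntegrableOn, ?_, fun φ h1 h2 h3 => ?_,
    fun φ h1 h2 h3 => ?_⟩
  · refine IntegrableOn.locallyIntegrableOn ?_
    rw [IntegrableOn, Omega, Measure.volume_eq_prod, ← Measure.prod_restrict] at hg' ⊢
    exact hg'.swap
  · exact integral_mul_fderiv_fst hc hg (countable_range (node lx N))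
      (fun y hyI x hxI => h.hasDerivAt_error hx hy hI hxI hyI) h1 h2 h3
  · exact integral_mul_fderiv_snd (g := fun p => DS 0 1 p + D₂ 0 1 p + D₁ 0 1 p + D₁₂ 0 1 p -
          gradX (u ∘ Prod.swap) ly lx N p.swap) hc' hg' (countable_range (node ly N))
      (fun y hyI x hxI => h.swap.hasDerivAt_error hy hx hI.swap hxI hyI) h1 h2 h3

end IsLayerSum

/-! ### Integrals of the pointwise bounds -/

/-- A bound in separated variables on a rectangle with sides of length at most one. -/
lemma setLIntegral_prod_le {A B : Set ℝ} (hA : MeasurableSet A) (hB : MeasurableSet B)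
    (vA : volume A ≤ 1) (vB : volume B ≤ 1) {F : ℝ × ℝ → ℝ} {φ ψ : ℝ → ℝ} {a Φ Ψ : ℝ}
    (hφ : Measurable φ) (hψ : Measurable ψ) (ha : 0 ≤ a) (hΦ0 : 0 ≤ Φ) (hΨ0 : 0 ≤ Ψ)
    (hF : ∀ p ∈ A ×ˢ B, F p ≤ a + φ p.1 + ψ p.2)
    (hΦ : ∫⁻ x in A, ENNReal.ofReal (φ x) ≤ ENNReal.ofReal Φ)
    (hΨ : ∫⁻ y in B, ENNReal.ofReal (ψ y) ≤ ENNReal.ofReal Ψ) :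
    ∫⁻ p in A ×ˢ B, ENNReal.ofReal (F p) ≤ ENNReal.ofReal (a + Φ + Ψ) := by
  calc ∫⁻ p in A ×ˢ B, ENNReal.ofReal (F p)
      ≤ ∫⁻ p in A ×ˢ B, (ENNReal.ofReal a + ENNReal.ofReal (φ p.1) * 1 +
          1 * ENNReal.ofReal (ψ p.2)) := by
        refine setLIntegral_mono' (hA.prod hB) fun p hp => ?_
        rw [mul_one, one_mul]
        refine (ENNReal.ofReal_le_ofReal (hF p hp)).trans ?_
        exact ENNReal.ofReal_add_le.trans (add_le_add_left ENNReal.ofReal_add_le _)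
    _ = ENNReal.ofReal a * (volume A * volume B) +
          (∫⁻ x in A, ENNReal.ofReal (φ x)) * volume B +
          volume A * ∫⁻ y in B, ENNReal.ofReal (ψ y) := by
        rw [lintegral_add_left (by fun_prop), lintegral_add_left (by fun_prop)]
        congr 1
        · congr 1
          · rw [setLIntegral_const, Measure.volume_eq_prod, Measure.prod_prod]
          · rw [Measure.volume_eq_prod, ← Measure.prod_restrict,
              lintegral_prod_mul (f := fun x => ENNReal.ofReal (φ x)) (g := fun _ => 1)
                (by fun_prop) (by fun_prop)]
            simp
        · rw [Measure.volume_eq_prod, ← Measure.prod_restrict,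
              lintegral_prod_mul (f := fun _ => 1) (g := fun x => ENNReal.ofReal (ψ x))
                (by fun_prop) (by fun_prop)]
          simp
    _ ≤ ENNReal.ofReal a * (1 * 1) + ENNReal.ofReal Φ * 1 + 1 * ENNReal.ofReal Ψ := by gcongr
    _ = ENNReal.ofReal (a + Φ + Ψ) := by
        rw [ENNReal.ofReal_add (by positivity) hΨ0, ENNReal.ofReal_add ha hΦ0]; simp

lemma setLIntegral_exp_le {A : Set ℝ} (hA : MeasurableSet A) {b c k : ℝ} (hAb : A ⊆ Iic b)
    (hc : 0 < c) (hk : 0 ≤ k) {φ : ℝ → ℝ} (hφ : ∀ x ∈ A, φ x ≤ k * Real.exp (c * (x - b))) :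
    ∫⁻ x in A, ENNReal.ofReal (φ x) ≤ ENNReal.ofReal (k / c) := by
  have e : (fun x => k * Real.exp (c * (x - b))) =
      fun x => (k * Real.exp (-(c * b))) * Real.exp (c * x) := by
    funext x
    rw [mul_assoc, ← Real.exp_add]
    ring_nf
  have hi : IntegrableOn (fun x => k * Real.exp (c * (x - b))) (Iic b) := by
    rw [e]
    exact (integrableOn_exp_mul_Iic hc b).const_mul _
  calc ∫⁻ x in A, ENNReal.ofReal (φ x)
      ≤ ∫⁻ x in A, ENNReal.ofReal (k * Real.exp (c * (x - b))) :=
        setLIntegral_mono' hA fun x hx => ENNReal.ofReal_le_ofReal (hφ x hx)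
    _ ≤ ∫⁻ x in Iic b, ENNReal.ofReal (k * Real.exp (c * (x - b))) := lintegral_mono_set hAb
    _ = ENNReal.ofReal (∫ x in Iic b, k * Real.exp (c * (x - b))) :=
        (ofReal_integral_eq_lintegral_ofReal hi
          (Filter.Eventually.of_forall fun x => by positivity)).symm
    _ = ENNReal.ofReal (k / c) := by
        rw [e, integral_const_mul, integral_exp_mul_Iic hc, mul_assoc, mul_div_assoc',
          ← Real.exp_add, neg_add_cancel, Real.exp_zero, mul_one_div]

lemma measurable_layer (ε β : ℝ) : Measurable (layer ε β) := by unfold layer; fun_prop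

lemma measurable_slope (ε β l : ℝ) (N : ℕ) : Measurable (slope ε β l N) :=
  (Measurable.ite measurableSet_Iio measurable_const measurable_const).mul
    ((measurable_layer ε β).const_mul _)

/-- The squared layer function as a multiple of an exponential normalized at `b`. -/
lemma layer_sq_eq (ε β b x : ℝ) :
    layer ε β x ^ 2 = layer ε β b ^ 2 * Real.exp (2 * β / ε * (x - b)) := by
  rw [layer, layer, ← Real.exp_nat_mul, ← Real.exp_nat_mul, ← Real.exp_add]
  congr 1
  push_cast
  ring

namespace IsMesh

variable {ε β l : ℝ} {N : ℕ} (h : IsMesh ε β l N)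
include h

lemma layer_transition_sq_le : layer ε β (1 - l) ^ 2 ≤ 1 / (N : ℝ) ^ 4 := by
  calc layer ε β (1 - l) ^ 2 ≤ (1 / (N : ℝ) ^ 2) ^ 2 :=
        pow_le_pow_left₀ (layer_pos _ _ _).le h.layer_transition_le 2
    _ = _ := by rw [div_pow, one_pow, ← pow_mul]

lemma coarse_subset : Ico 0 (1 - l) ⊆ Ico (0 : ℝ) 1 :=
  Ico_subset_Ico_right (by linarith [h.width_pos])

lemma lintegral_coarse_le {m : ℝ} (hm : 0 ≤ m) :
    ∫⁻ x in Ico 0 (1 - l), ENNReal.ofReal (m * (ε⁻¹ * layer ε β x) ^ 2) ≤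
      ENNReal.ofReal (m * (1 / (N : ℝ) ^ 4 * (ε⁻¹ / (2 * β)))) := by
  have hε := h.eps_pos
  have hβ := h.beta_pos
  have hN := h.natCast_pos
  refine (setLIntegral_exp_le measurableSet_Ico (b := 1 - l) (c := 2 * β / ε)
    (k := m * (ε⁻¹ ^ 2 * (1 / (N : ℝ) ^ 4))) (fun x hx => hx.2.le) (by positivity) (by positivity)
    (fun x _ => ?_)).trans (le_of_eq ?_)
  · rw [mul_pow, layer_sq_eq ε β (1 - l) x, ← mul_assoc (ε⁻¹ ^ 2), ← mul_assoc m]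
    gcongr
    exact h.layer_transition_sq_le
  · congr 1; field_simp

/-- The squared gradient of the layer integrates to `O(ε⁻¹ · rate N ^ 2)`: on the coarse part
because the layer has decayed there, on the fine part because of the factor `rate N` in `slope`. -/
lemma lintegral_slope_le {m : ℝ} (hm : 0 ≤ m) :
    ∫⁻ x in Ico 0 1, ENNReal.ofReal (m * slope ε β l N x ^ 2) ≤
      ENNReal.ofReal (m * (3 * rate N ^ 2 * ε⁻¹ / β)) := by
  have hε := h.eps_pos
  have hβ := h.beta_pos
  have hN := h.natCast_pos
  have hr := h.rate_nonneg
  have hU : Ico (0 : ℝ) 1 = Ico 0 (1 - l) ∪ Ico (1 - l) 1 :=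
    (Ico_union_Ico_eq_Ico (by linarith [h.lt_one]) (by linarith [h.width_pos])).symm
  have e₁ : ∫⁻ x in Ico 0 (1 - l), ENNReal.ofReal (m * slope ε β l N x ^ 2) ≤
      ENNReal.ofReal (m * (1 / (N : ℝ) ^ 4 * (ε⁻¹ / (2 * β)))) := by
    refine le_trans (le_of_eq (setLIntegral_congr_fun measurableSet_Ico fun x hx => ?_))
      (h.lintegral_coarse_le hm)
    simp only [slope, if_pos hx.2, one_mul]
  have e₂ : ∫⁻ x in Ico (1 - l) 1, ENNReal.ofReal (m * slope ε β l N x ^ 2) ≤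
      ENNReal.ofReal (m * (rate N ^ 2 * (ε⁻¹ / (2 * β)))) := by
    refine (setLIntegral_exp_le measurableSet_Ico (b := 1) (c := 2 * β / ε)
      (k := m * (rate N ^ 2 * ε⁻¹ ^ 2)) (fun x hx => hx.2.le) (by positivity) (by positivity)
      (fun x hx => le_of_eq ?_)).trans (le_of_eq ?_)
    · have h1 : layer ε β 1 = 1 := by simp [layer]
      rw [slope, if_neg (not_lt.2 hx.1), mul_pow, mul_pow, layer_sq_eq ε β 1 x, h1]
      ring
    · congr 1; field_simp
  rw [hU]
  refine (lintegral_union_le _ _ _).trans ((add_le_add e₁ e₂).trans ?_)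
  rw [← ENNReal.ofReal_add (by positivity) (by positivity)]
  apply ENNReal.ofReal_le_ofReal
  rw [← mul_add, ← add_mul]
  apply mul_le_mul_of_nonneg_left _ hm
  have h4 : 1 / (N : ℝ) ^ 4 ≤ 4 * rate N ^ 2 := by
    have h0 : 0 ≤ 1 / (N : ℝ) := by positivity
    have h1 : (1 / (N : ℝ)) ^ 2 ≤ (2 * rate N) ^ 2 := pow_le_pow_left₀ h0 h.inv_le_rate 2
    have h2 : 1 / (N : ℝ) ≤ 1 := by
      rw [div_le_one hN]; exact_mod_cast h.pos
    have h3 : (1 / (N : ℝ)) ^ 4 ≤ (1 / (N : ℝ)) ^ 2 := pow_le_pow_of_le_one h0 h2 (by norm_num)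
    rw [← one_div_pow]
    linarith
  calc (1 / (N : ℝ) ^ 4 + rate N ^ 2) * (ε⁻¹ / (2 * β))
      ≤ (4 * rate N ^ 2 + 2 * rate N ^ 2) * (ε⁻¹ / (2 * β)) := by
        gcongr
        linarith [sq_nonneg (rate N)]
    _ = 3 * rate N ^ 2 * ε⁻¹ / β := by field_simp; ring

end IsMesh

lemma two_mul_add_sq_le {g K a b : ℝ} (h : |g| ≤ K * (a + b)) :
    g ^ 2 ≤ 2 * K ^ 2 * (a ^ 2 + b ^ 2) := by
  have h1 : g ^ 2 ≤ (K * (a + b)) ^ 2 := sq_le_sq' (by linarith [(abs_le.1 h).1]) (abs_le.1 h).2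
  nlinarith [mul_nonneg (sq_nonneg K) (sq_nonneg (a - b))]

lemma setLIntegral_OmegaS (lx ly : ℝ) (f : ℝ × ℝ → ℝ≥0∞) :
    ∫⁻ p in OmegaS lx ly, f p = ∫⁻ p in Ico 0 (1 - lx) ×ˢ Ico 0 (1 - ly), f p :=
  setLIntegral_congr (Measure.set_prod_ae_eq Ico_ae_eq_Icc.symm Ico_ae_eq_Icc.symm)

section Energy

variable {ε β₁ β₂ lx ly : ℝ} {N : ℕ} (hx : IsMesh ε β₁ lx N) (hy : IsMesh ε β₂ ly N)
  {K μ₀ : ℝ} (hμ : 0 < μ₀) {w : ℝ × ℝ → ℝ} {g : ℝ × ℝ → ℝ × ℝ}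
include hx hy hμ

/-- A gradient error of size `rate N + slope` has energy of order `rate N ^ 2`, because the weight
`ε` of the gradient cancels the `ε⁻¹` in the integral of `slope ^ 2`. -/
lemma energyForm_Omega_le
    (hw : ∀ p ∈ Ico (0 : ℝ) 1 ×ˢ Ico (0 : ℝ) 1, |w p| ≤ K * rate N)
    (h₁ : ∀ p ∈ Ico (0 : ℝ) 1 ×ˢ Ico (0 : ℝ) 1,
      |(g p).1| ≤ K * (rate N + slope ε β₁ lx N p.1))
    (h₂ : ∀ p ∈ Ico (0 : ℝ) 1 ×ˢ Ico (0 : ℝ) 1,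
      |(g p).2| ≤ K * (rate N + slope ε β₂ ly N p.2)) :
    energyForm ε μ₀ Omega w g ≤
      ENNReal.ofReal (K ^ 2 * (4 + 6 / β₁ + 6 / β₂ + μ₀) * rate N ^ 2) := by
  have hε := hx.eps_pos
  have hβ₁ := hx.beta_pos
  have hβ₂ := hy.beta_pos
  have hr := hx.rate_nonneg
  have hsub : Omega ⊆ Ico (0 : ℝ) 1 ×ˢ Ico (0 : ℝ) 1 :=
    prod_mono Ioo_subset_Ico_self Ioo_subset_Ico_self
  have v1 : volume (Ico (0 : ℝ) 1) ≤ 1 := by simp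
  have hε1 : ε ≤ 1 := hx.eps_le.trans (inv_le_one_of_one_le₀ (by exact_mod_cast hx.pos))
  have eg : ∫⁻ p in Omega, ENNReal.ofReal ((g p).1 ^ 2 + (g p).2 ^ 2) ≤
      ENNReal.ofReal (4 * K ^ 2 * rate N ^ 2 + 2 * K ^ 2 * (3 * rate N ^ 2 * ε⁻¹ / β₁) +
        2 * K ^ 2 * (3 * rate N ^ 2 * ε⁻¹ / β₂)) := by
    refine (lintegral_mono_set hsub).trans (setLIntegral_prod_le measurableSet_Ico
      measurableSet_Ico v1 v1 (((measurable_slope ε β₁ lx N).pow_const 2).const_mul (2 * K ^ 2))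
      (((measurable_slope ε β₂ ly N).pow_const 2).const_mul (2 * K ^ 2)) (by positivity)
      (by positivity) (by positivity) (fun p hp => ?_)
      (hx.lintegral_slope_le (by positivity)) (hy.lintegral_slope_le (by positivity)))
    linarith [two_mul_add_sq_le (h₁ p hp), two_mul_add_sq_le (h₂ p hp)]
  have ew : ∫⁻ p in Omega, ENNReal.ofReal (w p ^ 2) ≤ ENNReal.ofReal (K ^ 2 * rate N ^ 2) := by
    calc _ ≤ ∫⁻ p in Omega, ENNReal.ofReal (K ^ 2 * rate N ^ 2) := by
          refine setLIntegral_mono' measurableSet_Omega fun p hp => ENNReal.ofReal_le_ofReal ?_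
          rw [← mul_pow]
          have := abs_le.1 (hw p (hsub hp))
          exact sq_le_sq' this.1 this.2
      _ = _ := by rw [setLIntegral_const, volume_Omega, mul_one]
  calc energyForm ε μ₀ Omega w g ≤ ENNReal.ofReal ε * _ + ENNReal.ofReal μ₀ * _ :=
        add_le_add (mul_le_mul_right eg _) (mul_le_mul_right ew _)
    _ ≤ _ := by
        rw [← ENNReal.ofReal_mul hε.le, ← ENNReal.ofReal_mul hμ.le,
          ← ENNReal.ofReal_add (by positivity) (by positivity)]
        apply ENNReal.ofReal_le_ofReal
        have e : ε * (4 * K ^ 2 * rate N ^ 2 + 2 * K ^ 2 * (3 * rate N ^ 2 * ε⁻¹ / β₁) +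
            2 * K ^ 2 * (3 * rate N ^ 2 * ε⁻¹ / β₂)) =
            ε * (4 * K ^ 2 * rate N ^ 2) + K ^ 2 * (6 / β₁ + 6 / β₂) * rate N ^ 2 := by
          field_simp; ring
        have : ε * (4 * K ^ 2 * rate N ^ 2) ≤ 1 * (4 * K ^ 2 * rate N ^ 2) := by gcongr
        rw [e]
        linarith

/-- On the coarse part the regular component contributes `ε N⁻²` through its gradient, and all the
remaining terms are of order `N⁻⁴`. -/
lemma energyForm_OmegaS_le
    (hw : ∀ p ∈ Ico 0 (1 - lx) ×ˢ Ico 0 (1 - ly), |w p| ≤ K * (1 / (N : ℝ) ^ 2))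
    (h₁ : ∀ p ∈ Ico 0 (1 - lx) ×ˢ Ico 0 (1 - ly),
      |(g p).1| ≤ K * (1 / N + ε⁻¹ * layer ε β₁ p.1))
    (h₂ : ∀ p ∈ Ico 0 (1 - lx) ×ˢ Ico 0 (1 - ly),
      |(g p).2| ≤ K * (1 / N + ε⁻¹ * layer ε β₂ p.2)) :
    energyForm ε μ₀ (OmegaS lx ly) w g ≤ ENNReal.ofReal
      (K ^ 2 * (4 + 1 / β₁ + 1 / β₂ + μ₀) * (ε * ((N : ℝ) ^ 2)⁻¹ + ((N : ℝ) ^ 4)⁻¹)) := by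
  have hε := hx.eps_pos
  have hβ₁ := hx.beta_pos
  have hβ₂ := hy.beta_pos
  have hN := hx.natCast_pos
  have v1 : volume (Ico 0 (1 - lx)) ≤ 1 :=
    (measure_mono hx.coarse_subset).trans (by simp)
  have v2 : volume (Ico 0 (1 - ly)) ≤ 1 :=
    (measure_mono hy.coarse_subset).trans (by simp)
  have eg : ∫⁻ p in OmegaS lx ly, ENNReal.ofReal ((g p).1 ^ 2 + (g p).2 ^ 2) ≤
      ENNReal.ofReal (4 * K ^ 2 * (1 / N) ^ 2 +
        2 * K ^ 2 * (1 / (N : ℝ) ^ 4 * (ε⁻¹ / (2 * β₁))) +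
        2 * K ^ 2 * (1 / (N : ℝ) ^ 4 * (ε⁻¹ / (2 * β₂)))) := by
    rw [setLIntegral_OmegaS]
    refine setLIntegral_prod_le measurableSet_Ico measurableSet_Ico v1 v2
      ((((measurable_layer ε β₁).const_mul ε⁻¹).pow_const 2).const_mul (2 * K ^ 2))
      ((((measurable_layer ε β₂).const_mul ε⁻¹).pow_const 2).const_mul (2 * K ^ 2)) (by positivity)
      (by positivity) (by positivity) (fun p hp => ?_)
      (hx.lintegral_coarse_le (by positivity)) (hy.lintegral_coarse_le (by positivity))
    linarith [two_mul_add_sq_le (h₁ p hp), two_mul_add_sq_le (h₂ p hp)]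
  have ew : ∫⁻ p in OmegaS lx ly, ENNReal.ofReal (w p ^ 2) ≤
      ENNReal.ofReal (K ^ 2 * (1 / (N : ℝ) ^ 2) ^ 2) := by
    rw [setLIntegral_OmegaS]
    calc _ ≤ ∫⁻ p in Ico 0 (1 - lx) ×ˢ Ico 0 (1 - ly),
            ENNReal.ofReal (K ^ 2 * (1 / (N : ℝ) ^ 2) ^ 2) := by
          refine setLIntegral_mono' (measurableSet_Ico.prod measurableSet_Ico) fun p hp =>
            ENNReal.ofReal_le_ofReal ?_
          rw [← mul_pow]
          have := abs_le.1 (hw p hp)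
          exact sq_le_sq' this.1 this.2
      _ ≤ _ := by
          rw [setLIntegral_const, Measure.volume_eq_prod, Measure.prod_prod]
          exact mul_le_of_le_one_right' (mul_le_one' v1 v2)
  calc energyForm ε μ₀ (OmegaS lx ly) w g ≤ ENNReal.ofReal ε * _ + ENNReal.ofReal μ₀ * _ :=
        add_le_add (mul_le_mul_right eg _) (mul_le_mul_right ew _)
    _ ≤ _ := by
        rw [← ENNReal.ofReal_mul hε.le, ← ENNReal.ofReal_mul hμ.le,
          ← ENNReal.ofReal_add (by positivity) (by positivity)]
        apply ENNReal.ofReal_le_ofReal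
        have e : ε * (4 * K ^ 2 * (1 / N) ^ 2 +
            2 * K ^ 2 * (1 / (N : ℝ) ^ 4 * (ε⁻¹ / (2 * β₁))) +
            2 * K ^ 2 * (1 / (N : ℝ) ^ 4 * (ε⁻¹ / (2 * β₂)))) +
            μ₀ * (K ^ 2 * (1 / (N : ℝ) ^ 2) ^ 2) =
            K ^ 2 * 4 * (ε * ((N : ℝ) ^ 2)⁻¹) +
              K ^ 2 * (1 / β₁ + 1 / β₂ + μ₀) * ((N : ℝ) ^ 4)⁻¹ := by
          field_simp
          ring
        have k1 : 0 ≤ K ^ 2 * (1 / β₁ + 1 / β₂ + μ₀) * (ε * ((N : ℝ) ^ 2)⁻¹) := by positivity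
        have k2 : 0 ≤ K ^ 2 * 4 * ((N : ℝ) ^ 4)⁻¹ := by positivity
        rw [e]
        linarith

end Energy

/-! ### The stabilization term -/

lemma taper_mem_Icc {ε β l : ℝ} {N : ℕ} (h : IsMesh ε β l N) {x : ℝ} (hx : x ∈ Ico 0 (1 - l)) :
    taper l N x ∈ Icc (0 : ℝ) 1 := by
  have hN := h.natCast_pos
  have hl : 0 < 1 - l := by linarith [h.lt_one]
  unfold taper
  split_ifs with hc
  · exact ⟨zero_le_one, le_rfl⟩
  · push Not at hc
    have hH : 0 < (1 - l) / (N / 2) := by positivity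
    exact ⟨div_nonneg (by linarith [hx.2]) hH.le, (div_le_one hH).2 (by linarith)⟩

/-- The taper vanishes at the transition point to first order on the scale `N⁻¹`, if the coarse
part of the mesh is not short. -/
lemma taper_le_mul {ε β l : ℝ} {N : ℕ} (h : IsMesh ε β l N) (hl : l ≤ 1 / 2) {x : ℝ}
    (hx : x ∈ Ico 0 (1 - l)) : taper l N x ≤ N * ((1 - l) - x) := by
  have hN := h.natCast_pos
  have hH : 1 / (N : ℝ) ≤ (1 - l) / (N / 2) := by
    rw [div_le_div_iff₀ hN (by positivity)]
    nlinarith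
  have hd : 0 ≤ (1 - l) - x := by linarith [hx.2]
  unfold taper
  split_ifs with hc
  · calc (1 : ℝ) = N * (1 / N) := by field_simp
      _ ≤ _ := by gcongr; linarith
  · calc ((1 - l) - x) / ((1 - l) / (N / 2)) ≤ ((1 - l) - x) / (1 / N) := by gcongr
      _ = _ := by field_simp

/-- The taper compensates the factor `ε⁻¹` that the squared gradient of a layer function carries
near the transition point, since `t e^{-t} ≤ 1`. -/
lemma taper_mul_layer_sq_le {ε β l : ℝ} {N : ℕ} (h : IsMesh ε β l N) {x : ℝ}
    (hx : x ∈ Ico 0 (1 - l)) :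
    taper l N x * (ε⁻¹ * layer ε β x) ^ 2 ≤ 25 / β ^ 2 * (1 / (N : ℝ) ^ 2) +
      1 / (N : ℝ) ^ 3 * ε⁻¹ / β * Real.exp (β / ε * (x - (1 - l))) := by
  have hε := h.eps_pos
  have hβ := h.beta_pos
  have hN := h.natCast_pos
  have ht := taper_mem_Icc h hx
  have hl0 := layer_pos ε β x
  rcases le_total l (1 / 2) with hl | hl
  · set z := (1 - l) - x with hz
    have hz0 : 0 ≤ z := by rw [hz]; linarith [hx.2]
    set X := Real.exp (β / ε * (x - (1 - l))) with hX
    have hXpos : 0 < X := Real.exp_pos _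
    have e1 : layer ε β x ^ 2 ≤ 1 / (N : ℝ) ^ 4 * (X * X) := by
      rw [layer_sq_eq ε β (1 - l) x, hX, ← Real.exp_add,
        show β / ε * (x - (1 - l)) + β / ε * (x - (1 - l)) = 2 * β / ε * (x - (1 - l)) by ring]
      gcongr
      exact h.layer_transition_sq_le
    have e2 : z * X ≤ ε / β := by
      -- half of the decay of the squared layer function is spent on absorbing the factor `z`
      have h1 : β / ε * z ≤ Real.exp (β / ε * z) := by
        linarith [Real.add_one_le_exp (β / ε * z)]
      have h2 : Real.exp (β / ε * z) * X = 1 := by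
        rw [hX, ← Real.exp_add, hz, ← Real.exp_zero]; congr 1; ring
      have h3 : β / ε * z * X ≤ 1 := by rw [← h2]; gcongr
      calc z * X = ε / β * (β / ε * z * X) := by field_simp
        _ ≤ ε / β * 1 := by gcongr
        _ = _ := mul_one _
    calc taper l N x * (ε⁻¹ * layer ε β x) ^ 2
        ≤ (N * z) * (ε⁻¹ ^ 2 * (1 / (N : ℝ) ^ 4 * (X * X))) := by
          rw [mul_pow]
          gcongr
          exact taper_le_mul h hl hx
      _ = 1 / (N : ℝ) ^ 3 * ε⁻¹ ^ 2 * (z * X) * X := by field_simp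
      _ ≤ 1 / (N : ℝ) ^ 3 * ε⁻¹ ^ 2 * (ε / β) * X := by gcongr
      _ = 1 / (N : ℝ) ^ 3 * ε⁻¹ / β * X := by field_simp
      _ ≤ _ := le_add_of_nonneg_left (by positivity)
  · have hlog := h.half_le_log
    have hr := h.rate_le_one
    have hr0 := h.rate_nonneg
    calc taper l N x * (ε⁻¹ * layer ε β x) ^ 2
        ≤ 1 * ((5 / β * Real.log N) * (1 / (N : ℝ) ^ 2)) ^ 2 := by
          gcongr
          · exact ht.2
          · exact h.inv_eps_le hl
          · exact h.layer_coarse_le hx.2.le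
      _ = 25 / β ^ 2 * (1 / (N : ℝ) ^ 2) * rate N ^ 2 := by rw [rate]; field_simp; norm_num
      _ ≤ 25 / β ^ 2 * (1 / (N : ℝ) ^ 2) * 1 := by
          gcongr
          exact pow_le_one₀ hr0 hr
      _ ≤ _ := by
          rw [mul_one]
          exact le_add_of_nonneg_right (by positivity)

section Stab

variable {ε β₁ β₂ lx ly : ℝ} {N : ℕ} (hx : IsMesh ε β₁ lx N) (hy : IsMesh ε β₂ ly N)
include hx hy

/-- The mesh rectangles overlap only in null sets. -/
lemma sum_setLIntegral_cell_le (D : Set (ℝ × ℝ)) (f : ℝ × ℝ → ℝ≥0∞)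
    (hf : ∀ p ∉ OmegaS lx ly, f p = 0) :
    ∑ i ∈ Finset.range N, ∑ j ∈ Finset.range N, ∫⁻ p in cell lx ly N i j ∩ D, f p ≤
      ∫⁻ p in OmegaS lx ly, f p := by
  let Q : ℕ × ℕ → Set (ℝ × ℝ) := fun k =>
    Ico (node lx N k.1) (node lx N (k.1 + 1)) ×ˢ Ico (node ly N k.2) (node ly N (k.2 + 1))
  have hQm : ∀ k, MeasurableSet (Q k) := fun k => measurableSet_Ico.prod measurableSet_Ico
  have hQd : Set.Pairwise (↑(Finset.range N ×ˢ Finset.range N)) (Function.onFun Disjoint Q) := by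
    intro k hk k' hk' hne
    refine Set.disjoint_left.2 fun p hp hp' => hne ?_
    simp only [Finset.coe_product, Finset.coe_range, mem_prod, mem_Iio] at hk hk'
    have a1 := meshIndex_eq hx.pos hx.even hx.width_pos hx.lt_one hk.1 hp.1
    have a2 := meshIndex_eq hx.pos hx.even hx.width_pos hx.lt_one hk'.1 hp'.1
    have b1 := meshIndex_eq hy.pos hy.even hy.width_pos hy.lt_one hk.2 hp.2
    have b2 := meshIndex_eq hy.pos hy.even hy.width_pos hy.lt_one hk'.2 hp'.2
    exact Prod.ext (a1.symm.trans a2) (b1.symm.trans b2)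
  have hS : MeasurableSet (OmegaS lx ly) := measurableSet_Icc.prod measurableSet_Icc
  calc _ ≤ ∑ i ∈ Finset.range N, ∑ j ∈ Finset.range N, ∫⁻ p in Q (i, j), f p := by
        refine Finset.sum_le_sum fun i _ => Finset.sum_le_sum fun j _ => ?_
        refine (lintegral_mono_set inter_subset_left).trans (le_of_eq ?_)
        exact setLIntegral_congr (Measure.set_prod_ae_eq Ico_ae_eq_Icc.symm Ico_ae_eq_Icc.symm)
    _ = ∑ k ∈ Finset.range N ×ˢ Finset.range N, ∫⁻ p in Q k, f p :=
        (Finset.sum_product' _ _ fun i j => ∫⁻ p in Q (i, j), f p).symm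
    _ = ∫⁻ p in ⋃ k ∈ Finset.range N ×ˢ Finset.range N, Q k, f p :=
        (lintegral_biUnion_finset hQd (fun k _ => hQm k) f).symm
    _ ≤ ∫⁻ p, f p := setLIntegral_le_lintegral _ _
    _ = ∫⁻ p in OmegaS lx ly, f p := by
        rw [← lintegral_indicator hS]
        congr 1
        exact (indicator_eq_self.2 fun p hp => by_contra fun h => hp (hf p h)).symm

/-- The stabilization term gains the factor `N⁻¹` of `δ` over the squared gradient, whose weighted
integral over the coarse part is of order `N⁻²` thanks to the taper. -/
lemma stabForm_le {K B Cstar : ℝ} (hC : 0 < Cstar) {b₁ b₂ : ℝ × ℝ → ℝ}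
    (hb₁ : ∀ p ∈ OmegaBar, |b₁ p| ≤ B) (hb₂ : ∀ p ∈ OmegaBar, |b₂ p| ≤ B)
    {g : ℝ × ℝ → ℝ × ℝ} (D : Set (ℝ × ℝ))
    (h₁ : ∀ p ∈ Ico 0 (1 - lx) ×ˢ Ico 0 (1 - ly),
      |(g p).1| ≤ K * (1 / N + ε⁻¹ * layer ε β₁ p.1))
    (h₂ : ∀ p ∈ Ico 0 (1 - lx) ×ˢ Ico 0 (1 - ly),
      |(g p).2| ≤ K * (1 / N + ε⁻¹ * layer ε β₂ p.2)) :
    stabForm b₁ b₂ Cstar lx ly N D g ≤ ENNReal.ofReal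
      (4 * Cstar * B ^ 2 * K ^ 2 * (2 + 26 / β₁ ^ 2 + 26 / β₂ ^ 2) * ((N : ℝ) ^ 3)⁻¹) := by
  have hε := hx.eps_pos
  have hβ₁ := hx.beta_pos
  have hβ₂ := hy.beta_pos
  have hN := hx.natCast_pos
  have v1 : volume (Ico 0 (1 - lx)) ≤ 1 :=
    (measure_mono hx.coarse_subset).trans (by simp)
  have v2 : volume (Ico 0 (1 - ly)) ≤ 1 :=
    (measure_mono hy.coarse_subset).trans (by simp)
  refine (sum_setLIntegral_cell_le hx hy D _ fun p hp => ?_).trans ?_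
  · simp [delta, hp]
  rw [setLIntegral_OmegaS]
  set k := 4 * Cstar * B ^ 2 * K ^ 2 * (1 / N) with hk
  have hk0 : 0 ≤ k := by positivity
  have hI : ∀ {β l : ℝ}, IsMesh ε β l N → ∫⁻ x in Ico 0 (1 - l), ENNReal.ofReal
      (k * (1 / (N : ℝ) ^ 3 * ε⁻¹ / β) * Real.exp (β / ε * (x - (1 - l)))) ≤
      ENNReal.ofReal (k * (1 / (N : ℝ) ^ 3 / β ^ 2)) := by
    intro β l hl
    have hβ := hl.beta_pos
    refine (setLIntegral_exp_le measurableSet_Ico (b := 1 - l) (c := β / ε)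
      (fun x hx => hx.2.le) (by positivity) (by positivity) (fun x _ => le_rfl)).trans
      (le_of_eq ?_)
    congr 1; field_simp
  refine (setLIntegral_prod_le measurableSet_Ico measurableSet_Ico v1 v2
    (a := k * (1 / (N : ℝ) ^ 2) * (2 + 25 / β₁ ^ 2 + 25 / β₂ ^ 2)) (by fun_prop) (by fun_prop)
    (by positivity) (by positivity) (by positivity) (fun p hp => ?_) (hI hx) (hI hy)).trans ?_
  · have hpO : p ∈ OmegaBar := ⟨Ico_subset_Icc_self (hx.coarse_subset hp.1),
      Ico_subset_Icc_self (hy.coarse_subset hp.2)⟩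
    have hpS : p ∈ OmegaS lx ly := ⟨Ico_subset_Icc_self hp.1, Ico_subset_Icc_self hp.2⟩
    have tx := taper_mem_Icc hx hp.1
    have ty := taper_mem_Icc hy hp.2
    have hδ : delta Cstar lx ly N p = Cstar * (N : ℝ)⁻¹ * taper lx N p.1 * taper ly N p.2 := by
      rw [delta, if_pos hpS]
    have hδ0 : 0 ≤ delta Cstar lx ly N p := by
      rw [hδ]
      exact mul_nonneg (mul_nonneg (by positivity) tx.1) ty.1
    rw [mul_pow, Real.sq_sqrt hδ0, hδ]
    set ξ := taper lx N p.1
    set η := taper ly N p.2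
    set G₁ := ε⁻¹ * layer ε β₁ p.1
    set G₂ := ε⁻¹ * layer ε β₂ p.2
    have hb : (b₁ p * (g p).1 + b₂ p * (g p).2) ^ 2 ≤ 2 * B ^ 2 * ((g p).1 ^ 2 + (g p).2 ^ 2) := by
      have q1 : b₁ p ^ 2 ≤ B ^ 2 := by
        have := abs_le.1 (hb₁ p hpO); exact sq_le_sq' this.1 this.2
      have q2 : b₂ p ^ 2 ≤ B ^ 2 := by
        have := abs_le.1 (hb₂ p hpO); exact sq_le_sq' this.1 this.2
      have r1 := mul_le_mul_of_nonneg_right q1 (sq_nonneg (g p).1)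
      have r2 := mul_le_mul_of_nonneg_right q2 (sq_nonneg (g p).2)
      linarith [sq_nonneg (b₁ p * (g p).1 - b₂ p * (g p).2)]
    have hg : (g p).1 ^ 2 + (g p).2 ^ 2 ≤ 2 * K ^ 2 * (2 * (1 / N) ^ 2 + G₁ ^ 2 + G₂ ^ 2) := by
      linarith [two_mul_add_sq_le (h₁ p hp), two_mul_add_sq_le (h₂ p hp)]
    have hd : ξ * η * (2 * (1 / (N : ℝ)) ^ 2 + G₁ ^ 2 + G₂ ^ 2) ≤
        2 * (1 / (N : ℝ)) ^ 2 + ξ * G₁ ^ 2 + η * G₂ ^ 2 := by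
      have s1 : ξ * η ≤ ξ := mul_le_of_le_one_right tx.1 ty.2
      have s2 : ξ * η ≤ η := mul_le_of_le_one_left ty.1 tx.2
      have s3 : ξ * η ≤ 1 := s1.trans tx.2
      have := mul_le_mul_of_nonneg_right s1 (sq_nonneg G₁)
      have := mul_le_mul_of_nonneg_right s2 (sq_nonneg G₂)
      have := mul_le_mul_of_nonneg_right s3 (sq_nonneg (1 / (N : ℝ)))
      linarith
    have t1 := mul_le_mul_of_nonneg_left (taper_mul_layer_sq_le hx hp.1) hk0
    have t2 := mul_le_mul_of_nonneg_left (taper_mul_layer_sq_le hy hp.2) hk0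
    calc Cstar * (N : ℝ)⁻¹ * ξ * η * (b₁ p * (g p).1 + b₂ p * (g p).2) ^ 2
        ≤ Cstar * (N : ℝ)⁻¹ * ξ * η *
          (2 * B ^ 2 * (2 * K ^ 2 * (2 * (1 / N) ^ 2 + G₁ ^ 2 + G₂ ^ 2))) := by
          refine mul_le_mul_of_nonneg_left (hb.trans ?_) (by
            rw [← hδ]; exact hδ0)
          gcongr
      _ = k * (ξ * η * (2 * (1 / (N : ℝ)) ^ 2 + G₁ ^ 2 + G₂ ^ 2)) := by rw [hk]; ring
      _ ≤ k * (2 * (1 / (N : ℝ)) ^ 2 + ξ * G₁ ^ 2 + η * G₂ ^ 2) := by gcongr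
      _ = k * (1 / (N : ℝ) ^ 2) * 2 + k * (ξ * G₁ ^ 2) + k * (η * G₂ ^ 2) := by
          rw [one_div_pow]; ring
      _ ≤ _ := by linarith
  · apply ENNReal.ofReal_le_ofReal
    have h32 : 1 / (N : ℝ) ^ 3 ≤ 1 / (N : ℝ) ^ 2 := by
      have : (1 : ℝ) ≤ N := by exact_mod_cast hx.pos
      gcongr
      norm_num
    calc _ ≤ k * (1 / (N : ℝ) ^ 2) * (2 + 25 / β₁ ^ 2 + 25 / β₂ ^ 2) +
          k * (1 / (N : ℝ) ^ 2 / β₁ ^ 2) + k * (1 / (N : ℝ) ^ 2 / β₂ ^ 2) := by gcongr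
      _ = _ := by rw [hk]; field_simp; ring

end Stab

/-! ### The interpolation error in the streamline diffusion norm -/

lemma sdNormSq_le {ε μ₀ Cstar lx ly a s : ℝ} {b₁ b₂ w : ℝ × ℝ → ℝ} {N : ℕ} {D : Set (ℝ × ℝ)}
    {g : ℝ × ℝ → ℝ × ℝ} (hg : IsWeakGradient (interior D) w g) (ha : 0 ≤ a) (hs : 0 ≤ s)
    (he : energyForm ε μ₀ D w g ≤ ENNReal.ofReal a)
    (hst : stabForm b₁ b₂ Cstar lx ly N D g ≤ ENNReal.ofReal s) :
    sdNormSq ε μ₀ b₁ b₂ Cstar lx ly N D w ≤ ENNReal.ofReal (a + s) := by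
  rw [ENNReal.ofReal_add ha hs]
  exact (iInf₂_le g hg).trans (add_le_add he hst)

lemma interior_OmegaS_subset {ε β₁ β₂ lx ly : ℝ} {N : ℕ} (hx : IsMesh ε β₁ lx N)
    (hy : IsMesh ε β₂ ly N) : interior (OmegaS lx ly) ⊆ Omega := by
  rw [OmegaS, interior_prod_eq, interior_Icc, interior_Icc]
  exact prod_mono (Ioo_subset_Ioo_right (by linarith [hx.width_pos]))
    (Ioo_subset_Ioo_right (by linarith [hy.width_pos]))

end SDFEM

theorem mainTheorem2 (β₁ β₂ μ₀ Cstar M : ℝ) (b₁ b₂ c : ℝ × ℝ → ℝ)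
    (hdata : IsCoefficientData β₁ β₂ μ₀ b₁ b₂ c) (hCstar : 0 < Cstar) (hM : 0 < M) :
    ∃ C : ℝ, 0 < C ∧
      ∀ (ε : ℝ) (N : ℕ) (lx ly : ℝ) (f u S E₁ E₂ E₁₂ uI : ℝ × ℝ → ℝ),
        0 < N → Even N → 0 < ε → ε ≤ (N : ℝ)⁻¹ →
        lx = layerWidth ε β₁ N → ly = layerWidth ε β₂ N → lx < 1 → ly < 1 →
        ContinuousOn f OmegaBar →
        IsSolution ε b₁ b₂ c f u →
        IsDecomposition ε β₁ β₂ M u S E₁ E₂ E₁₂ →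
        IsBilinearInterpolant lx ly N u uI →
        sdNorm ε μ₀ b₁ b₂ Cstar lx ly N Omega (fun p => u p - uI p)
            ≤ ENNReal.ofReal (C * (N : ℝ)⁻¹ * Real.log N) ∧
        energyNormSq ε μ₀ (OmegaS lx ly) (fun p => u p - uI p)
            ≤ ENNReal.ofReal (C * (ε * ((N : ℝ) ^ 2)⁻¹ + ((N : ℝ) ^ 4)⁻¹)) ∧
        sdNormSq ε μ₀ b₁ b₂ Cstar lx ly N (OmegaS lx ly) (fun p => u p - uI p)
            ≤ ENNReal.ofReal (C * ((N : ℝ) ^ 3)⁻¹) := by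
  have hβ₁ := hdata.beta₁_pos
  have hβ₂ := hdata.beta₂_pos
  have hμ := hdata.mu₀_pos
  obtain ⟨B₁, hB₁⟩ := isCompact_OmegaBar.exists_bound_of_continuousOn hdata.smooth_b₁.continuousOn
  obtain ⟨B₂, hB₂⟩ := isCompact_OmegaBar.exists_bound_of_continuousOn hdata.smooth_b₂.continuousOn
  set B := max B₁ B₂ with hB
  have hb₁ : ∀ p ∈ OmegaBar, |b₁ p| ≤ B := fun p hp => (hB₁ p hp).trans (le_max_left _ _)
  have hb₂ : ∀ p ∈ OmegaBar, |b₂ p| ≤ B := fun p hp => (hB₂ p hp).trans (le_max_right _ _)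
  set K := errConst β₁ β₂ M with hK
  -- the constants in the bounds of the energy form on `Ω`, of the energy form on `Ω_s` and of the
  -- stabilization form
  set A₁ := (10 * K) ^ 2 * (4 + 6 / β₁ + 6 / β₂ + μ₀) with hA₁
  set A₂ := (4 * K) ^ 2 * (4 + 1 / β₁ + 1 / β₂ + μ₀) with hA₂
  set A₃ := 4 * Cstar * B ^ 2 * (4 * K) ^ 2 * (2 + 26 / β₁ ^ 2 + 26 / β₂ ^ 2) with hA₃
  have hA₁0 : 0 ≤ A₁ := by positivity
  have hA₂0 : 0 ≤ A₂ := by positivity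
  have hA₃0 : 0 ≤ A₃ := by positivity
  refine ⟨√(A₁ + 4 * A₃) + 2 * A₂ + A₃ + 1, by positivity, ?_⟩
  intro ε N lx ly f u S E₁ E₂ E₁₂ uI hN hE hε hεN hlx hly hlx1 hly1 _ _ hdec hI
  have hx : IsMesh ε β₁ lx N := ⟨hN, hE, hε, hεN, hβ₁, hlx, hlx1⟩
  have hy : IsMesh ε β₂ ly N := ⟨hN, hE, hε, hεN, hβ₂, hly, hly1⟩
  obtain ⟨DS, D₁, D₂, D₁₂, h⟩ := hdec.exists_isLayerSum
  -- the elementwise gradient of the interpolation error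
  set g : ℝ × ℝ → ℝ × ℝ := fun p =>
    (DS 1 0 p + D₁ 1 0 p + D₂ 1 0 p + D₁₂ 1 0 p - gradX u lx ly N p,
      DS 0 1 p + D₂ 0 1 p + D₁ 0 1 p + D₁₂ 0 1 p - gradX (u ∘ Prod.swap) ly lx N p.swap)
  have hw : IsWeakGradient Omega (fun p => u p - uI p) g := h.isWeakGradient_error hx hy hM hI
  have hN0 := hx.natCast_pos
  have hN1 : (1 : ℝ) ≤ N := by exact_mod_cast hN
  have hr := hx.rate_nonneg
  have hKc : errConst β₂ β₁ M = K := by rw [hK, errConst_comm]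
  have hsqrt := Real.sqrt_nonneg (A₁ + 4 * A₃)
  have hgx : ∀ p ∈ Ico 0 (1 - lx) ×ˢ Ico 0 (1 - ly),
      |(g p).1| ≤ 4 * K * (1 / N + ε⁻¹ * layer ε β₁ p.1) := fun p hp =>
    h.abs_gradX_error_le_coarse hx hy hM hp
  have hgy : ∀ p ∈ Ico 0 (1 - lx) ×ˢ Ico 0 (1 - ly),
      |(g p).2| ≤ 4 * K * (1 / N + ε⁻¹ * layer ε β₂ p.2) := fun p hp =>
    hKc ▸ h.swap.abs_gradX_error_le_coarse hy hx hM (p := p.swap) ⟨hp.2, hp.1⟩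
  have stab := fun D => stabForm_le hx hy hCstar hb₁ hb₂ D hgx hgy
  have eS := energyForm_OmegaS_le hx hy hμ
    (fun p hp => h.abs_value_error_le_coarse hx hy hM hI hp) hgx hgy
  have hgX : ∀ p ∈ Ico (0 : ℝ) 1 ×ˢ Ico (0 : ℝ) 1,
      |(g p).1| ≤ 10 * K * (rate N + slope ε β₁ lx N p.1) := fun p hp =>
    h.abs_gradX_error_le hx hy hM hp
  have hgY : ∀ p ∈ Ico (0 : ℝ) 1 ×ˢ Ico (0 : ℝ) 1,
      |(g p).2| ≤ 10 * K * (rate N + slope ε β₂ ly N p.2) := fun p hp =>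
    hKc ▸ h.swap.abs_gradX_error_le hy hx hM (p := p.swap) ⟨hp.2, hp.1⟩
  have eO := energyForm_Omega_le hx hy hμ
    (fun p hp => h.abs_value_error_le hx hy hM hI hp) hgX hgY
  have hwS := hw.mono measurableSet_Omega (interior_OmegaS_subset hx hy)
  refine ⟨?_, ?_, ?_⟩
  · have hwO : IsWeakGradient (interior Omega) _ _ := hw.mono measurableSet_Omega interior_subset
    have hsq := sdNormSq_le hwO (by positivity) (by positivity) eO (stab Omega)
    have h3 : ((N : ℝ) ^ 3)⁻¹ ≤ 4 * rate N ^ 2 := by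
      have h1 : (1 / (N : ℝ)) ^ 2 ≤ (2 * rate N) ^ 2 :=
        pow_le_pow_left₀ (by positivity) hx.inv_le_rate 2
      have h2 : ((N : ℝ) ^ 3)⁻¹ ≤ ((N : ℝ) ^ 2)⁻¹ := by
        gcongr
        norm_num
      rw [one_div, inv_pow] at h1
      linarith
    have hle : A₁ * rate N ^ 2 + A₃ * ((N : ℝ) ^ 3)⁻¹ ≤ (√(A₁ + 4 * A₃) * rate N) ^ 2 := by
      rw [mul_pow, Real.sq_sqrt (by positivity)]
      have := mul_le_mul_of_nonneg_left h3 hA₃0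
      linarith
    have hfin : √(A₁ + 4 * A₃) * rate N ≤
        (√(A₁ + 4 * A₃) + 2 * A₂ + A₃ + 1) * (N : ℝ)⁻¹ * Real.log N := by
      rw [show (√(A₁ + 4 * A₃) + 2 * A₂ + A₃ + 1) * (N : ℝ)⁻¹ * Real.log N =
        (√(A₁ + 4 * A₃) + 2 * A₂ + A₃ + 1) * rate N by rw [rate]; ring]
      gcongr
      linarith
    calc sdNorm ε μ₀ b₁ b₂ Cstar lx ly N Omega (fun p => u p - uI p)
        ≤ ENNReal.ofReal ((√(A₁ + 4 * A₃) * rate N) ^ 2) ^ (1 / 2 : ℝ) :=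
          ENNReal.rpow_le_rpow (hsq.trans (ENNReal.ofReal_le_ofReal hle)) (by norm_num)
      _ = ENNReal.ofReal (√(A₁ + 4 * A₃) * rate N) := by
          rw [ENNReal.ofReal_rpow_of_nonneg (by positivity) (by norm_num), ← Real.sqrt_eq_rpow,
            Real.sqrt_sq (by positivity)]
      _ ≤ _ := ENNReal.ofReal_le_ofReal hfin
  · refine (iInf₂_le _ hwS).trans (eS.trans (ENNReal.ofReal_le_ofReal ?_))
    gcongr
    linarith
  · refine (sdNormSq_le hwS (by positivity) (by positivity) eS (stab _)).trans
      (ENNReal.ofReal_le_ofReal ?_)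
    have h3 : ε * ((N : ℝ) ^ 2)⁻¹ + ((N : ℝ) ^ 4)⁻¹ ≤ 2 * ((N : ℝ) ^ 3)⁻¹ := by
      have h1 : ε * ((N : ℝ) ^ 2)⁻¹ ≤ (N : ℝ)⁻¹ * ((N : ℝ) ^ 2)⁻¹ := by gcongr
      have h2 : ((N : ℝ) ^ 4)⁻¹ ≤ ((N : ℝ) ^ 3)⁻¹ := by
        gcongr
        norm_num
      have e : (N : ℝ)⁻¹ * ((N : ℝ) ^ 2)⁻¹ = ((N : ℝ) ^ 3)⁻¹ := by rw [← mul_inv]; ring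
      linarith
    have h4 := mul_le_mul_of_nonneg_left h3 hA₂0
    have h5 : 0 ≤ (√(A₁ + 4 * A₃) + 1) * ((N : ℝ) ^ 3)⁻¹ := by positivity
    linarith
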